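/- Let $\bar n=(n_1,n_2,\dots)$ be a sequence of integers $n_i\ge 2$, put $p_m=n_1\cdots n_m$, and let $K$ be a field with an involution that is positive definite, i.e. $\sum_{j=1}^r \overline{a_j}\,a_j=0$ implies $a_1=\dots=a_r=0$. Let $X=\prod_i\{0,\dots,n_i-1\}$ carry the product topology and the product $\mu$ of the uniform probability measures, and let $T:X\to X$ be the odometer (addition of $(1,0,0,\dots)$ with carry over). The generalized odometer algebra is the crossed product $*$-algebra $\mathcal O(\bar n)=C_K(X)\rtimes_T\mathbb Z$, where $C_K(X)$ is the algebra of locally constant functions $X\to K$, and $t f t^{-1}=f\circ T^{-1}$ for the generator $t$ of $\mathbb Z$. Let $E_m\subseteq X$ be the set of sequences whose first $m$ digits are $0$, so that $\mu(E_m)=1/p_m$. Let $\mathfrak R_{\mathrm{rk}}$ be the completion of $\varinjlim_m M_{p_m}(K)$ (with the block-diagonal embeddings $x\mapsto\mathrm{diag}(x,\dots,x)$) in the metric $d(x,y)=\mathrm{rk}(x-y)$ given by the normalized rank, which is $\mathrm{rk}(A)=\mu(E_m)\,\mathrm{Rank}(A)$ for $A\in M_k(M_{p_m}(K))=M_{kp_m}(K)$;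 the involution of $\mathfrak R_{\mathrm{rk}}$ extends conjugate transposition, and $\mathrm{rk}$ extends by continuity to matrices over $\mathfrak R_{\mathrm{rk}}$. The algebra $\mathcal O(\bar n)$ is mapped to $\mathfrak R_{\mathrm{rk}}$ by the $*$-homomorphism that sends a locally constant $f$, at every level $m$ at which $f$ is constant on the sets $T^i(E_m)$, to the diagonal matrix of its values on $T^i(E_m)$, $0\le i<p_m$, and that sends $t$ to $\lim_m\sum_{i=0}^{p_m-2}e_{i+1,i}$, with $e_{ij}$ the matrix units of $M_{p_m}(K)$. Let $\mathrm{rk}_{\mathcal O(\bar n)}$ be the rank function on matrices over $\mathcal O(\bar n)$ obtained through this map. Let $\mathcal R_{\mathcal O(\bar n)}$ be the $*$-regular closure of $\mathcal O(\bar n)$, i.e. the smallest unital $*$-regular subring of $\mathfrak R_{\mathrm{rk}}$ that contains the image of $\mathcal O(\bar n)$, with the restricted rank function $\mathrm{rk}_{\mathcal R_{\mathcal O(\bar n)}}$. Put $$\mathcal C'(\mathcal O(\bar n))=\{\mathrm{rk}_{\mathcal O(\bar n)}(A): k\ge1,\ A\in M_k(\mathcal O(\bar n))\},\qquad \mathcal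 C(\mathcal O(\bar n))=\{k-\mathrm{rk}_{\mathcal O(\bar n)}(A): k\ge1,\ A\in M_k(\mathcal O(\bar n))\},$$ $$\mathcal C'(\mathcal R_{\mathcal O(\bar n)})=\{\mathrm{rk}_{\mathcal R_{\mathcal O(\bar n)}}(A): k\ge1,\ A\in M_k(\mathcal R_{\mathcal O(\bar n)})\},$$ and let $\mathcal G(\mathcal O(\bar n))$ be the subgroup of $(\mathbb R,+)$ generated by the set $\mathcal C(\mathcal O(\bar n))$ of $\mathcal O(\bar n)$-Betti numbers. Let $n=\prod_i n_i$ be the supernatural number of $\bar n$: the exponent $\varepsilon_q(n)\in\{0,1,2,\dots,\infty\}$ of a prime $q$ in it is the sum over $i$ of the exponents of $q$ in the $n_i$. Let $\mathbb Z(n)\subseteq\mathbb Q$ be the group of all fractions $a/b$ with $a\in\mathbb Z$ and $b\geq 1$ an integer in which every prime $q$ has exponent at most $\varepsilon_q(n)$ (equivalently, of all fractions $a/(n_1\cdots n_r)$ with $a\in\mathbb Z$, $r\ge1$), and let $\mathbb Z(n)^+$ be the set of its nonnegative elements. Then $$\mathcal C'(\mathcal O(\bar n))=\mathcal C(\mathcal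 O(\bar n))=\mathcal C'(\mathcal R_{\mathcal O(\bar n)})=\mathbb Z(n)^+ .$$ In particular, $\mathcal G(\mathcal O(\bar n))=\mathbb Z(n)$. -/

import Mathlib

namespace Odometer

noncomputable section

set_option linter.unusedSectionVars false

open Filter Topology MeasureTheory Matrix Kronecker

/-! ### The dynamical system -/

/-- The space `X = ∏ i, {0, …, n i - 1}` with the product of the discrete topologies. -/
abbrev Space (n : ℕ → ℕ) : Type := ∀ i, Fin (n i)

section Dynamics

variable (n : ℕ → ℕ) [∀ i, (n i).AtLeastTwo]

open Classical in
/-- Addition of `(1, 0, 0, …)` with carry over: the digit `x i` is raised by `1` (cyclically) when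
all earlier digits are maximal, and is kept otherwise. -/
def addOne (x : Space n) : Space n :=
  fun i => if ∀ j < i, (x j : ℕ) + 1 = n j then x i + 1 else x i

open Classical in
/-- Subtraction of `(1, 0, 0, …)` with borrow. -/
def subOne (x : Space n) : Space n :=
  fun i => if ∀ j < i, (x j : ℕ) = 0 then x i - 1 else x i

variable {n}

theorem two_le (i : ℕ) : 2 ≤ n i := Nat.AtLeastTwo.prop

theorem val_add_one_eq_zero_iff {k : ℕ} [NeZero k] (a : Fin k) :
    ((a + 1 : Fin k) : ℕ) = 0 ↔ (a : ℕ) + 1 = k := by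
  obtain ⟨k, rfl⟩ : ∃ m, k = m + 1 := Nat.exists_eq_succ_of_ne_zero (NeZero.ne k)
  have h := Fin.val_add_one a
  have ha := a.isLt
  have hl : a = Fin.last k ↔ (a : ℕ) = k := by rw [Fin.ext_iff, Fin.val_last]
  split_ifs at h with h1
  · exact ⟨fun _ => by rw [hl.1 h1], fun _ => h⟩
  · exact ⟨fun h2 => absurd (h.symm.trans h2) (by omega),
      fun h2 => absurd (hl.2 (by omega)) h1⟩

theorem val_sub_one_add_one_iff {k : ℕ} [NeZero k] (a : Fin k) :
    ((a - 1 : Fin k) : ℕ) + 1 = k ↔ (a : ℕ) = 0 := by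
  rw [← val_add_one_eq_zero_iff, sub_add_cancel]

theorem addOne_carry_iff (x : Space n) (i : ℕ) :
    (∀ j < i, (addOne n x j : ℕ) = 0) ↔ ∀ j < i, (x j : ℕ) + 1 = n j := by
  induction i with
  | zero => simp
  | succ i ih =>
    simp only [Nat.lt_succ_iff_lt_or_eq, or_imp, forall_and, forall_eq]
    rw [ih]
    refine and_congr_right fun h => ?_
    rw [addOne, if_pos h, val_add_one_eq_zero_iff]

theorem subOne_carry_iff (x : Space n) (i : ℕ) :
    (∀ j < i, (subOne n x j : ℕ) + 1 = n j) ↔ ∀ j < i, (x j : ℕ) = 0 := by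
  induction i with
  | zero => simp
  | succ i ih =>
    simp only [Nat.lt_succ_iff_lt_or_eq, or_imp, forall_and, forall_eq]
    rw [ih]
    refine and_congr_right fun h => ?_
    rw [subOne, if_pos h, val_sub_one_add_one_iff]

theorem subOne_addOne (x : Space n) : subOne n (addOne n x) = x := by
  funext i
  by_cases h : ∀ j < i, (x j : ℕ) + 1 = n j
  · rw [subOne, if_pos ((addOne_carry_iff x i).2 h), addOne, if_pos h, add_sub_cancel_right]
  · rw [subOne, if_neg (mt (addOne_carry_iff x i).1 h), addOne, if_neg h]

theorem addOne_subOne (x : Space n) : addOne n (subOne n x) = x := by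
  funext i
  by_cases h : ∀ j < i, (x j : ℕ) = 0
  · rw [addOne, if_pos ((subOne_carry_iff x i).2 h), subOne, if_pos h, sub_add_cancel]
  · rw [addOne, if_neg (mt (subOne_carry_iff x i).1 h), subOne, if_neg h]

/-- A self-map of `X` whose `i`-th digit depends only on the digits up to `i` is continuous. -/
theorem continuous_of_digits {g : Space n → Space n}
    (hg : ∀ i x x', (∀ j ≤ i, x j = x' j) → g x i = g x' i) : Continuous g := by
  refine continuous_pi fun i => continuous_discrete_rng.2 fun b => ?_
  refine isOpen_iff_mem_nhds.2 fun x hx => ?_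
  refine mem_of_superset ((PiNat.isOpen_cylinder _ x (i + 1)).mem_nhds
    (PiNat.self_mem_cylinder x _)) fun x' hx' => ?_
  rw [Set.mem_preimage, hg i x' x fun j hj => hx' j (Nat.lt_succ_of_le hj)]
  exact hx

variable (n)

/-- The odometer `T : X → X`. -/
def T : Space n ≃ₜ Space n where
  toFun := addOne n
  invFun := subOne n
  left_inv := subOne_addOne
  right_inv := addOne_subOne
  continuous_toFun := continuous_of_digits fun i x x' h => by
    have : (∀ j < i, (x j : ℕ) + 1 = n j) ↔ ∀ j < i, (x' j : ℕ) + 1 = n j :=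
      forall₂_congr fun j hj => by rw [h j hj.le]
    simp only [addOne, this, h i le_rfl]
  continuous_invFun := continuous_of_digits fun i x x' h => by
    have : (∀ j < i, (x j : ℕ) = 0) ↔ ∀ j < i, (x' j : ℕ) = 0 :=
      forall₂_congr fun j hj => by rw [h j hj.le]
    simp only [subOne, this, h i le_rfl]

/-- The product measure `μ` on `X` of the uniform probability measures on the factors. -/
def mu : Measure (Space n) :=
  Measure.infinitePi fun i => (PMF.uniformOfFintype (Fin (n i))).toMeasure

instance : IsProbabilityMeasure (mu n) := by
  unfold mu; infer_instance

/-- The point `y = (0, 0, …)`. -/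
def zero : Space n := fun _ => 0

/-- The cylinder set `E_m = [0 0 ⋯ 0]` (with `m` zeros). -/
def E (m : ℕ) : Set (Space n) := {x | ∀ i < m, x i = 0}

end Dynamics

/-- The product `p_m` of the first `m` terms of the sequence. -/
def p (n : ℕ → ℕ) (m : ℕ) : ℕ := ∏ i ∈ Finset.range m, n i

section Levels

variable {n : ℕ → ℕ} [∀ i, (n i).AtLeastTwo]

theorem p_succ (m : ℕ) : p n (m + 1) = p n m * n m := Finset.prod_range_succ _ _

theorem p_dvd {m l : ℕ} (h : m ≤ l) : p n m ∣ p n l :=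
  Finset.prod_dvd_prod_of_subset _ _ _ (Finset.range_mono h)

theorem two_pow_le_p (m : ℕ) : 2 ^ m ≤ p n m := by
  induction m with
  | zero => simp [p]
  | succ m ih => rw [p_succ, pow_succ]; exact Nat.mul_le_mul ih (two_le m)

theorem p_pos (m : ℕ) : 0 < p n m := (by positivity : 0 < 2 ^ m).trans_le (two_pow_le_p m)

instance (m : ℕ) : NeZero (p n m) := ⟨(p_pos m).ne'⟩

/-- The clopen set `E_m` has measure `1 / p_m`. -/
theorem mu_E (m : ℕ) : (mu n (E n m)).toReal = (p n m : ℝ)⁻¹ := by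
  have h : E n m = Set.pi (Finset.range m : Set ℕ) fun i => ({0} : Set (Fin (n i))) := by
    ext x; simp [E]
  rw [h, mu, Measure.infinitePi_pi _ fun i _ => MeasurableSet.singleton _]
  simp [p, ENNReal.toReal_prod]

theorem carry_iff_dvd (i k : ℕ) :
    (∀ j < k, i / p n j % n j + 1 = n j) ↔ p n k ∣ i + 1 := by
  induction k with
  | zero => simp [p]
  | succ k ih =>
    simp only [Nat.lt_succ_iff_lt_or_eq, or_imp, forall_and, forall_eq]
    rw [ih]
    have hp := p_pos (n := n) k
    have hn : 0 < n k := (two_le k).trans_lt' (by norm_num)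
    constructor
    · rintro ⟨⟨q, hq⟩, h2⟩
      have hq0 : 0 < q := by
        rcases Nat.eq_zero_or_pos q with rfl | h
        · simp at hq
        · exact h
      obtain ⟨r, rfl⟩ : ∃ r, q = r + 1 := ⟨q - 1, by omega⟩
      have h3 : i / p n k = r := by
        apply Nat.div_eq_of_lt_le
        · nlinarith
        · nlinarith
      rw [h3] at h2
      rw [p_succ, hq]
      refine Nat.mul_dvd_mul_left _ ⟨r / n k + 1, ?_⟩
      have := Nat.div_add_mod r (n k)
      rw [mul_add]; omega
    · rintro ⟨q, hq⟩
      rw [p_succ] at hq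
      refine ⟨⟨n k * q, by rw [hq, mul_assoc]⟩, ?_⟩
      have hq0 : 0 < q := by
        rcases Nat.eq_zero_or_pos q with rfl | h
        · simp at hq
        · exact h
      obtain ⟨r, rfl⟩ : ∃ r, q = r + 1 := ⟨q - 1, by omega⟩
      have h3 : i / p n k = n k * r + (n k - 1) := by
        obtain ⟨c, hc⟩ : ∃ c, n k = c + 1 := ⟨n k - 1, by omega⟩
        rw [hc] at hq ⊢
        apply Nat.div_eq_of_lt_le
        · simp only [Nat.add_sub_cancel]; nlinarith
        · simp only [Nat.add_sub_cancel]; nlinarith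
      rw [h3, Nat.mul_add_mod, Nat.mod_eq_of_lt (by omega)]
      omega

/-- The digits of `T^i (0, 0, …)`. -/
theorem val_T_pow_zero (i j : ℕ) : (((T n ^ i) (zero n)) j : ℕ) = i / p n j % n j := by
  induction i generalizing j with
  | zero => simp [zero]
  | succ i ih =>
    have hp := p_pos (n := n) j
    have hn : 1 < n j := two_le j
    rw [pow_succ', Homeomorph.mul_apply]
    change (addOne n ((T n ^ i) (zero n)) j : ℕ) = _
    have hc := carry_iff_dvd (n := n) i j
    simp only [← ih] at hc
    by_cases h : p n j ∣ i + 1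
    · rw [addOne, if_pos (hc.2 h), Fin.val_add, ih, Nat.succ_div_of_dvd h, Fin.val_one', ← Nat.add_mod]
    · rw [addOne, if_neg (mt hc.1 h), ih, Nat.succ_div_of_not_dvd h]

/-- The first `m` digits of `T^i (0, 0, …)` depend only on `i` modulo `p_m`. -/
theorem T_pow_mod {m j : ℕ} (h : j < m) (i : ℕ) :
    ((T n ^ (i % p n m)) (zero n)) j = ((T n ^ i) (zero n)) j := by
  apply Fin.ext
  obtain ⟨c, hc⟩ := p_dvd (n := n) (Nat.succ_le_of_lt h)
  rw [val_T_pow_zero, val_T_pow_zero, ← Nat.mod_mul_right_div_self, ← Nat.mod_mul_right_div_self,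
    ← p_succ, hc, Nat.mod_mul_right_mod]

/-- A locally constant function on `X` depends only on finitely many digits. -/
theorem exists_level {Y : Type*} (f : LocallyConstant (Space n) Y) :
    ∃ m, ∀ x x' : Space n, (∀ i < m, x i = x' i) → f x = f x' := by
  have h1 : ∀ x : Space n, ∃ m, PiNat.cylinder x m ⊆ f ⁻¹' {f x} := fun x =>
    (PiNat.isTopologicalBasis_cylinders fun i => Fin (n i)).mem_nhds_iff.1
      ((f.isLocallyConstant.isOpen_fiber (f x)).mem_nhds rfl) |> fun ⟨s, hs, hx, hsub⟩ => by
        obtain ⟨z, m, rfl⟩ := hs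
        exact ⟨m, by rwa [PiNat.mem_cylinder_iff_eq.1 hx]⟩
  choose M hM using h1
  obtain ⟨t, ht⟩ := isCompact_univ.elim_nhds_subcover (fun x : Space n => PiNat.cylinder x (M x))
    fun x _ => (PiNat.isOpen_cylinder _ x _).mem_nhds (PiNat.self_mem_cylinder x _)
  refine ⟨t.sup M, fun x x' hxx => ?_⟩
  obtain ⟨z, hz, hxz⟩ := Set.mem_iUnion₂.1 (ht.2 (Set.mem_univ x))
  have h2 : x' ∈ PiNat.cylinder z (M z) := fun i hi => by
    rw [← hxx i (hi.trans_le (Finset.le_sup (f := M) hz)), hxz i hi]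
  exact (hM z hxz).trans (hM z h2).symm

theorem tendsto_inv_p : Tendsto (fun m => (p n m : ℝ)⁻¹) atTop (𝓝 0) := by
  refine squeeze_zero (fun m => by positivity) (fun m => ?_)
    (tendsto_pow_atTop_nhds_zero_of_lt_one (r := (1 / 2 : ℝ)) (by norm_num) (by norm_num))
  rw [one_div, inv_pow]
  exact inv_anti₀ (by positivity) (by exact_mod_cast two_pow_le_p m)

end Levels

/-! ### The matrix algebras `M_{p_m}(K)` and their embeddings -/

section Rank

variable {K : Type*} [Field K] {ι κ : Type*} [Fintype ι] [DecidableEq ι] [Fintype κ]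
  [DecidableEq κ]

theorem rank_add_le (A B : Matrix ι ι K) : (A + B).rank ≤ A.rank + B.rank := by
  have h : LinearMap.range (A + B).mulVecLin ≤
      LinearMap.range A.mulVecLin ⊔ LinearMap.range B.mulVecLin := by
    rintro _ ⟨v, rfl⟩
    rw [mulVecLin_apply, add_mulVec]
    exact Submodule.add_mem_sup ⟨v, rfl⟩ ⟨v, rfl⟩
  exact (Submodule.finrank_mono h).trans (Submodule.finrank_add_le_finrank_add_finrank _ _)

theorem rank_neg (A : Matrix ι ι K) : (-A).rank = A.rank := by
  refine le_antisymm ?_ ?_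
  · simpa using Matrix.rank_mul_le_right (-1 : Matrix ι ι K) A
  · simpa using Matrix.rank_mul_le_right (-1 : Matrix ι ι K) (-A)

theorem exists_units_mul_eq_diagonal (A : Matrix ι ι K) :
    ∃ (V U : Matrix ι ι K) (w : ι → K), IsUnit V ∧ IsUnit U ∧ V * A * U = diagonal w ∧
      ∀ i, w i = 0 ∨ w i = 1 := by
  obtain ⟨V, U, e, hV, hU, h⟩ := A.exists_rank_normal_form
  refine ⟨V, U, fun i => Sum.elim (fun _ => 1) (fun _ => 0) (e i), hV, hU, ?_, ?_⟩
  · rw [h, ← diagonal_one, ← diagonal_zero, fromBlocks_diagonal, submatrix_diagonal_equiv]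
    rfl
  · intro i
    beta_reduce
    rcases h : e i with a | a
    · exact Or.inr rfl
    · exact Or.inl rfl

theorem rank_conjTranspose_eq [StarRing K] (A : Matrix ι ι K) : Aᴴ.rank = A.rank := by
  obtain ⟨V, U, w, hV, hU, h, hw⟩ := exists_units_mul_eq_diagonal A
  have h1 : A.rank = (diagonal w).rank := by
    rw [← h, rank_mul_eq_left_of_isUnit_det _ _ ((isUnit_iff_isUnit_det _).1 hU),
      rank_mul_eq_right_of_isUnit_det _ _ ((isUnit_iff_isUnit_det _).1 hV)]
  have h2 : Uᴴ * (Aᴴ * Vᴴ) = diagonal w := by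
    have hs : star w = w := funext fun i => by rcases hw i with h | h <;> simp [h]
    rw [← conjTranspose_mul, ← conjTranspose_mul, h, diagonal_conjTranspose, hs]
  have hV' : IsUnit Vᴴ := hV.star
  have hU' : IsUnit Uᴴ := hU.star
  rw [h1, ← h2, rank_mul_eq_right_of_isUnit_det _ _ ((isUnit_iff_isUnit_det _).1 hU'),
    rank_mul_eq_left_of_isUnit_det _ _ ((isUnit_iff_isUnit_det _).1 hV')]

theorem rank_one_kronecker (A : Matrix ι ι K) :
    ((1 : Matrix κ κ K) ⊗ₖ A).rank = Fintype.card κ * A.rank := by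
  classical
  obtain ⟨V, U, w, hV, hU, h, -⟩ := exists_units_mul_eq_diagonal A
  have h1 : A.rank = (diagonal w).rank := by
    rw [← h, rank_mul_eq_left_of_isUnit_det _ _ ((isUnit_iff_isUnit_det _).1 hU),
      rank_mul_eq_right_of_isUnit_det _ _ ((isUnit_iff_isUnit_det _).1 hV)]
  have h2 : ((1 : Matrix κ κ K) ⊗ₖ V) * ((1 : Matrix κ κ K) ⊗ₖ A) * ((1 : Matrix κ κ K) ⊗ₖ U)
      = diagonal fun x : κ × ι => w x.2 := by
    rw [← mul_kronecker_mul, ← mul_kronecker_mul, h, one_mul, one_mul, ← diagonal_one,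
      diagonal_kronecker_diagonal]
    simp
  have hu : ∀ W : Matrix ι ι K, IsUnit W → IsUnit (((1 : Matrix κ κ K) ⊗ₖ W).det) := fun W hW => by
    rw [det_kronecker]
    simpa using ((isUnit_iff_isUnit_det _).1 hW).pow _
  rw [← rank_mul_eq_right_of_isUnit_det _ ((1 : Matrix κ κ K) ⊗ₖ A) (hu V hV),
    ← rank_mul_eq_left_of_isUnit_det _ (((1 : Matrix κ κ K) ⊗ₖ V) * _) (hu U hU), h2, h1,
    rank_diagonal, rank_diagonal, ← Fintype.card_prod]
  refine Fintype.card_congr ⟨fun x => (x.1.1, ⟨x.1.2, x.2⟩), fun x => ⟨(x.1, x.2.1), x.2.2⟩,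
    fun _ => rfl, fun _ => rfl⟩

end Rank

section Embeddings

variable (n : ℕ → ℕ) [∀ i, (n i).AtLeastTwo] (K : Type*) [Field K]

/-- The matrix algebra `M_{p_m}(K)`, with rows and columns indexed by `0, …, p_m - 1`. -/
abbrev Mat (m : ℕ) : Type _ := Matrix (Fin (p n m)) (Fin (p n m)) K

variable {n} {K}

/-- The index `q * p_m + i` with `i < p_m` corresponds to the `i`-th position of the `q`-th block
of size `p_m`. -/
def blockEquiv {m l : ℕ} (h : m ≤ l) : Fin (p n l / p n m) × Fin (p n m) ≃ Fin (p n l) :=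
  finProdFinEquiv.trans (finCongr (Nat.div_mul_cancel (p_dvd h)))

/-- The block-diagonal embedding `x ↦ diag(x, …, x)` of `M_{p_m}(K)` into `M_{p_l}(K)`. -/
def emb {m l : ℕ} (h : m ≤ l) : Mat n K m →+* Mat n K l where
  toFun x := reindex (blockEquiv h) (blockEquiv h)
    ((1 : Matrix (Fin (p n l / p n m)) (Fin (p n l / p n m)) K) ⊗ₖ x)
  map_one' := by simp
  map_mul' x y := by
    simp only [reindex_apply]
    rw [submatrix_mul_equiv, ← mul_kronecker_mul, one_mul]
  map_zero' := by simp
  map_add' x y := by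
    rw [kronecker_add]; rfl

theorem emb_apply {m l : ℕ} (h : m ≤ l) (x : Mat n K m) (a b : Fin (p n l)) :
    emb h x a b = if (a : ℕ) / p n m = b / p n m then
      x ⟨a % p n m, Nat.mod_lt _ (p_pos m)⟩ ⟨b % p n m, Nat.mod_lt _ (p_pos m)⟩ else 0 := by
  simp only [emb, RingHom.coe_mk, MonoidHom.coe_mk, OneHom.coe_mk, reindex_apply, submatrix_apply,
    kroneckerMap_apply, one_apply, ite_mul, one_mul, zero_mul]
  simp only [blockEquiv, Equiv.symm_trans_apply, finProdFinEquiv_symm_apply, Fin.ext_iff,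
    Fin.coe_divNat]
  rfl

theorem emb_conjTranspose [StarRing K] {m l : ℕ} (h : m ≤ l) (x : Mat n K m) :
    emb h xᴴ = (emb h x)ᴴ := by
  ext a b
  simp only [conjTranspose_apply, emb_apply, eq_comm (a := (b : ℕ) / p n m)]
  split_ifs <;> simp

variable (n) in
/-- The normalized rank `rk_m(A) = μ(E_m) * Rank(A)` of a matrix `A` over `M_{p_m}(K)`, where
`k × k` matrices over `M_{p_m}(K)` are regarded as matrices of size `k * p_m` over `K`. -/
def rkLevel (m : ℕ) {k : ℕ} (A : Matrix (Fin k) (Fin k) (Mat n K m)) : ℝ :=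
  (mu n (E n m)).toReal * (Matrix.comp _ _ _ _ K A).rank

/-- The rank `rk_m(x) = μ(E_m) * Rank(x)` of a single element `x` of `M_{p_m}(K)`. -/
def rkElem {m : ℕ} (x : Mat n K m) : ℝ := (mu n (E n m)).toReal * x.rank

theorem rkElem_nonneg {m : ℕ} (x : Mat n K m) : 0 ≤ rkElem x := by
  unfold rkElem; positivity

theorem rkElem_zero {m : ℕ} : rkElem (0 : Mat n K m) = 0 := by simp [rkElem]

theorem rkElem_neg {m : ℕ} (x : Mat n K m) : rkElem (-x) = rkElem x := by
  rw [rkElem, rank_neg, rkElem]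

theorem rkElem_add_le {m : ℕ} (x y : Mat n K m) : rkElem (x + y) ≤ rkElem x + rkElem y := by
  rw [rkElem, rkElem, rkElem, ← mul_add]
  exact mul_le_mul_of_nonneg_left (by exact_mod_cast rank_add_le x y) ENNReal.toReal_nonneg

theorem rkElem_mul_le_left {m : ℕ} (x y : Mat n K m) : rkElem (x * y) ≤ rkElem x :=
  mul_le_mul_of_nonneg_left (by exact_mod_cast rank_mul_le_left x y) ENNReal.toReal_nonneg

theorem rkElem_mul_le_right {m : ℕ} (x y : Mat n K m) : rkElem (x * y) ≤ rkElem y :=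
  mul_le_mul_of_nonneg_left (by exact_mod_cast rank_mul_le_right x y) ENNReal.toReal_nonneg

theorem rkElem_conjTranspose [StarRing K] {m : ℕ} (x : Mat n K m) : rkElem xᴴ = rkElem x := by
  rw [rkElem, rank_conjTranspose_eq, rkElem]

/-- A matrix whose nonzero rows lie in `s` has normalized rank at most `#s / p_m`. -/
theorem rkElem_le_card {m : ℕ} (x : Mat n K m) (s : Finset (Fin (p n m)))
    (h : ∀ i ∉ s, ∀ j, x i j = 0) : rkElem x ≤ (p n m : ℝ)⁻¹ * s.card := by
  rw [rkElem, mu_E]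
  refine mul_le_mul_of_nonneg_left ?_ (by positivity)
  have := rank_le_card_of_support_subset x s
    (Function.support_subset_iff'.2 fun i hi => funext fun j => h i hi j)
  exact_mod_cast this

/-! ### The rank completion -/

section Completion

variable (n K)

/-- Sequences `(x_m)` with `x_m` in `M_{p_m}(K)` that are Cauchy in the direct limit of the algebras
`M_{p_m}(K)` with respect to the rank metric. -/
def cauchy : Subring (∀ m, Mat n K m) where
  carrier := {x | ∀ ε > 0, ∃ N, ∀ m l, ∀ h : m ≤ l, N ≤ m → rkElem (x l - emb h (x m)) < ε}
  one_mem' ε hε := ⟨0, fun m l h _ => by simpa [rkElem_zero] using hε⟩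
  zero_mem' ε hε := ⟨0, fun m l h _ => by simpa [rkElem_zero] using hε⟩
  add_mem' {x y} hx hy ε hε := by
    obtain ⟨N, hN⟩ := hx (ε / 2) (half_pos hε)
    obtain ⟨M, hM⟩ := hy (ε / 2) (half_pos hε)
    refine ⟨max N M, fun m l h hm => ?_⟩
    have h1 := hN m l h ((le_max_left _ _).trans hm)
    have h2 := hM m l h ((le_max_right _ _).trans hm)
    have h3 : (x + y) l - emb h ((x + y) m) = (x l - emb h (x m)) + (y l - emb h (y m)) := by
      simp only [Pi.add_apply, map_add]; abel
    rw [h3]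
    linarith [rkElem_add_le (x l - emb h (x m)) (y l - emb h (y m))]
  mul_mem' {x y} hx hy ε hε := by
    obtain ⟨N, hN⟩ := hx (ε / 2) (half_pos hε)
    obtain ⟨M, hM⟩ := hy (ε / 2) (half_pos hε)
    refine ⟨max N M, fun m l h hm => ?_⟩
    have h1 := hN m l h ((le_max_left _ _).trans hm)
    have h2 := hM m l h ((le_max_right _ _).trans hm)
    have h3 : (x * y) l - emb h ((x * y) m)
        = (x l - emb h (x m)) * y l + emb h (x m) * (y l - emb h (y m)) := by
      simp only [Pi.mul_apply, map_mul]; noncomm_ring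
    rw [h3]
    linarith [rkElem_add_le ((x l - emb h (x m)) * y l) (emb h (x m) * (y l - emb h (y m))),
      rkElem_mul_le_left (x l - emb h (x m)) (y l),
      rkElem_mul_le_right (emb h (x m)) (y l - emb h (y m))]
  neg_mem' {x} hx ε hε := by
    obtain ⟨N, hN⟩ := hx ε hε
    refine ⟨N, fun m l h hm => ?_⟩
    have h3 : (-x) l - emb h ((-x) m) = -(x l - emb h (x m)) := by
      simp only [Pi.neg_apply, map_neg]; abel
    rw [h3, rkElem_neg]
    exact hN m l h hm

/-- The ideal of sequences of rank converging to zero. -/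
def null : Ideal (cauchy n K) where
  carrier := {x | Tendsto (fun m => rkElem (x.1 m)) atTop (𝓝 0)}
  zero_mem' := by simp [rkElem_zero]
  add_mem' {x y} hx hy := by
    refine squeeze_zero (fun m => rkElem_nonneg _) (fun m => rkElem_add_le (x.1 m) (y.1 m)) ?_
    simpa using Tendsto.add hx hy
  smul_mem' c x hx :=
    squeeze_zero (fun m => rkElem_nonneg _) (fun m => rkElem_mul_le_right (c.1 m) (x.1 m)) hx

theorem mem_null {x : cauchy n K} :
    x ∈ null n K ↔ Tendsto (fun m => rkElem (x.1 m)) atTop (𝓝 0) := Iff.rfl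

instance : (null n K).IsTwoSided :=
  ⟨fun {x} b hx =>
    squeeze_zero (fun _ => rkElem_nonneg _) (fun m => rkElem_mul_le_left (x.1 m) (b.1 m)) hx⟩

/-- The completion of the direct limit of the `M_{p_m}(K)` with respect to the rank metric. -/
def Completion : Type _ := cauchy n K ⧸ null n K

instance : Ring (Completion n K) := Ideal.Quotient.ring (null n K)

/-- The class of a Cauchy sequence. -/
def cls : cauchy n K →+* Completion n K := Ideal.Quotient.mk (null n K)

variable {n K} in
theorem cls_eq_iff {x x' : cauchy n K} : cls n K x = cls n K x' ↔ x - x' ∈ null n K :=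
  Ideal.Quotient.eq

/-- A Cauchy sequence that represents an element of the completion. -/
def rep (a : Completion n K) : cauchy n K := Quotient.out a

variable {n K} in
theorem cls_rep (a : Completion n K) : cls n K (rep n K a) = a := Quotient.out_eq a

section Star

variable [StarRing K]

instance : StarRing (cauchy n K) where
  star x := ⟨fun m => (x.1 m)ᴴ, fun ε hε => by
    obtain ⟨N, hN⟩ := x.2 ε hε
    refine ⟨N, fun m l h hm => ?_⟩
    rw [emb_conjTranspose, ← conjTranspose_sub, rkElem_conjTranspose]
    exact hN m l h hm⟩
  star_involutive x := Subtype.ext (funext fun _ => conjTranspose_conjTranspose _)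
  star_mul x y := Subtype.ext (funext fun _ => conjTranspose_mul _ _)
  star_add x y := Subtype.ext (funext fun _ => conjTranspose_add _ _)

variable {n K} in
theorem star_apply (x : cauchy n K) (m : ℕ) : (star x).1 m = (x.1 m)ᴴ := rfl

variable {n K} in
theorem star_mem_null {x : cauchy n K} (hx : x ∈ null n K) : star x ∈ null n K := by
  rw [mem_null] at hx ⊢
  simpa only [star_apply, rkElem_conjTranspose] using hx

/-- The involution of the completion extends conjugate transposition of matrices. -/
instance : StarRing (Completion n K) where
  star := Quotient.lift (fun x => cls n K (star x)) fun x y h => by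
    have h1 : x - y ∈ null n K := (Submodule.quotientRel_def _).1 h
    refine cls_eq_iff.2 ?_
    rw [← star_sub]
    exact star_mem_null h1
  star_involutive := by
    rintro ⟨x⟩; exact congrArg (cls n K) (star_star x)
  star_mul := by
    rintro ⟨x⟩ ⟨y⟩; exact congrArg (cls n K) (star_mul x y)
  star_add := by
    rintro ⟨x⟩ ⟨y⟩; exact congrArg (cls n K) (star_add x y)

variable {n K} in
theorem star_cls (x : cauchy n K) : star (cls n K x) = cls n K (star x) := rfl

end Star

variable {n K}

/-- The extension of the rank functions `rk_m` to matrices over the completion: the limit of the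
ranks along Cauchy sequences that represent the entries. -/
def rkCompletion {k : ℕ} (A : Matrix (Fin k) (Fin k) (Completion n K)) : ℝ :=
  limUnder atTop fun m => rkLevel n m (A.map fun a => (rep n K a).1 m)


theorem rkLevel_add_le (m : ℕ) {k : ℕ} (A B : Matrix (Fin k) (Fin k) (Mat n K m)) :
    rkLevel n m (A + B) ≤ rkLevel n m A + rkLevel n m B := by
  rw [rkLevel, rkLevel, rkLevel, ← mul_add]
  refine mul_le_mul_of_nonneg_left ?_ ENNReal.toReal_nonneg
  exact_mod_cast rank_add_le (Matrix.comp _ _ _ _ K A) (Matrix.comp _ _ _ _ K B)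

theorem rkLevel_neg (m : ℕ) {k : ℕ} (A : Matrix (Fin k) (Fin k) (Mat n K m)) :
    rkLevel n m (-A) = rkLevel n m A := by
  rw [rkLevel, rkLevel]
  congr 2
  exact rank_neg (Matrix.comp _ _ _ _ K A)

theorem rkLevel_single_le (m : ℕ) {k : ℕ} (i j : Fin k) (x : Mat n K m) :
    rkLevel n m (Matrix.single i j x) ≤ rkElem x := by
  rw [rkLevel, rkElem]
  refine mul_le_mul_of_nonneg_left ?_ ENNReal.toReal_nonneg
  have h : Matrix.comp _ _ _ _ K (Matrix.single i j x) =
      (Matrix.of fun (a : Fin k × Fin (p n m)) b => if a.1 = i ∧ a.2 = b then (1 : K) else 0) *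
      (x * Matrix.of fun b (a : Fin k × Fin (p n m)) => if a.1 = j ∧ a.2 = b then (1 : K) else 0) := by
    ext ⟨a, a'⟩ ⟨b, b'⟩
    simp only [Matrix.comp_apply, Matrix.single_apply, Matrix.mul_apply, Matrix.of_apply, ite_and,
      ite_mul, one_mul, zero_mul, mul_ite, mul_one, mul_zero]
    by_cases h1 : a = i <;> by_cases h2 : b = j <;>
      simp [h1, h2, eq_comm (a := i), eq_comm (a := j)]
  rw [h]
  refine Nat.cast_le.2 ?_
  exact (Matrix.rank_mul_le_right _ _).trans (Matrix.rank_mul_le_left x _)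

theorem rkLevel_le_sum (m : ℕ) {k : ℕ} (A : Matrix (Fin k) (Fin k) (Mat n K m)) :
    rkLevel n m A ≤ ∑ i, ∑ j, rkElem (A i j) := by
  have h0 : rkLevel n m (0 : Matrix (Fin k) (Fin k) (Mat n K m)) = 0 := by
    have : Matrix.comp _ _ _ _ K (0 : Matrix (Fin k) (Fin k) (Mat n K m)) = 0 := rfl
    rw [rkLevel, this, rank_zero]; simp
  have hs : ∀ {ι : Type} (s : Finset ι) (F : ι → Matrix (Fin k) (Fin k) (Mat n K m)),
      rkLevel n m (∑ i ∈ s, F i) ≤ ∑ i ∈ s, rkLevel n m (F i) := fun s F =>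
    Finset.le_sum_of_subadditive _ h0.le (fun A B => rkLevel_add_le m A B) s F
  have hA : rkLevel n m A = rkLevel n m (∑ i, ∑ j, Matrix.single i j (A i j)) :=
    congrArg _ (Matrix.matrix_eq_sum_single A)
  refine hA.le.trans ?_
  refine (hs Finset.univ fun i => ∑ j, Matrix.single i j (A i j)).trans ?_
  refine Finset.sum_le_sum fun i _ => ?_
  refine (hs Finset.univ fun j => Matrix.single i j (A i j)).trans ?_
  exact Finset.sum_le_sum fun j _ => rkLevel_single_le m i j _

theorem abs_rkLevel_sub_le (m : ℕ) {k : ℕ} (A B : Matrix (Fin k) (Fin k) (Mat n K m)) :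
    |rkLevel n m A - rkLevel n m B| ≤ ∑ i, ∑ j, rkElem (A i j - B i j) := by
  refine le_trans ?_ (rkLevel_le_sum m (A - B))
  have h1 := rkLevel_add_le m (A - B) B
  have h2 := rkLevel_add_le m (-(A - B)) A
  rw [rkLevel_neg] at h2
  rw [sub_add_cancel] at h1
  rw [neg_sub, sub_add_cancel] at h2
  exact abs_sub_le_iff.2 ⟨by linarith, by linarith⟩

/-- The rank functions `rk_m` are compatible with the block-diagonal embeddings. -/
theorem rkLevel_emb {m l : ℕ} (h : m ≤ l) {k : ℕ} (A : Matrix (Fin k) (Fin k) (Mat n K m)) :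
    rkLevel n l (A.map (emb h)) = rkLevel n m A := by
  let e : Fin (p n l / p n m) × (Fin k × Fin (p n m)) ≃ Fin k × Fin (p n l) :=
    (Equiv.prodAssoc _ _ _).symm.trans (((Equiv.prodComm _ _).prodCongr (Equiv.refl _)).trans
      ((Equiv.prodAssoc _ _ _).trans ((Equiv.refl _).prodCongr (blockEquiv h))))
  have he : Matrix.comp _ _ _ _ K (A.map (emb h)) = reindex e e
      ((1 : Matrix (Fin (p n l / p n m)) (Fin (p n l / p n m)) K) ⊗ₖ Matrix.comp _ _ _ _ K A) := by
    ext ⟨a, a'⟩ ⟨b, b'⟩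
    rfl
  rw [rkLevel, rkLevel, he, rank_reindex, rank_one_kronecker, mu_E, mu_E, Fintype.card_fin]
  have h1 : (p n m : ℝ) ≠ 0 := by exact_mod_cast (p_pos m).ne'
  have h2 : (p n l : ℝ) ≠ 0 := by exact_mod_cast (p_pos l).ne'
  rw [Nat.cast_mul, Nat.cast_div (p_dvd h) h1]
  field_simp

/-- The rank of a matrix over the completion is the limit of the ranks along any Cauchy sequences
that represent its entries. -/
theorem tendsto_rkLevel {k : ℕ} (B : Matrix (Fin k) (Fin k) (cauchy n K)) :
    Tendsto (fun m => rkLevel n m (B.map fun x => x.1 m)) atTop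
      (𝓝 (rkCompletion (B.map (cls n K)))) := by
  have hconv : ∀ B : Matrix (Fin k) (Fin k) (cauchy n K),
      CauchySeq fun m => rkLevel n m (B.map fun x => x.1 m) := fun B => by
    refine Metric.cauchySeq_iff'.2 fun ε hε => ?_
    have hδ : 0 < ε / (k * k + 1 : ℝ) := by positivity
    choose N hN using fun i j => (B i j).2 _ hδ
    let M := Finset.univ.sup fun i => Finset.univ.sup fun j => N i j
    refine ⟨M, fun l hl => ?_⟩
    rw [Real.dist_eq, ← rkLevel_emb hl]
    refine (abs_rkLevel_sub_le _ _ _).trans_lt ?_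
    have h1 : ∀ i j, rkElem ((B.map fun x => x.1 l) i j
        - ((B.map fun x => x.1 M).map (emb hl)) i j) ≤ ε / (k * k + 1 : ℝ) := fun i j =>
      (hN i j M l hl ((Finset.le_sup (f := fun j => N i j) (Finset.mem_univ j)).trans
        (Finset.le_sup (f := fun i => Finset.univ.sup fun j => N i j) (Finset.mem_univ i)))).le
    refine (Finset.sum_le_sum fun i _ => Finset.sum_le_sum fun j _ => h1 i j).trans_lt ?_
    simp only [Finset.sum_const, Finset.card_univ, Fintype.card_fin, nsmul_eq_mul]
    rw [← mul_assoc, mul_div_assoc', div_lt_iff₀ (by positivity)]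
    nlinarith
  let C : Matrix (Fin k) (Fin k) (cauchy n K) := (B.map (cls n K)).map (rep n K)
  have h1 : Tendsto (fun m => rkLevel n m (C.map fun x => x.1 m)) atTop
      (𝓝 (rkCompletion (B.map (cls n K)))) := tendsto_nhds_limUnder (cauchySeq_tendsto_of_complete (hconv C))
  have h2 : Tendsto (fun m => ∑ i, ∑ j, rkElem ((B i j).1 m - (C i j).1 m)) atTop (𝓝 0) := by
    have : (0 : ℝ) = ∑ i : Fin k, ∑ j : Fin k, (0 : ℝ) := by simp
    rw [this]
    refine tendsto_finsetSum _ fun i _ => tendsto_finsetSum _ fun j _ => ?_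
    exact cls_eq_iff.1 (cls_rep (cls n K (B i j))).symm
  have h3 : Tendsto (fun m => rkLevel n m (B.map fun x => x.1 m)
      - rkLevel n m (C.map fun x => x.1 m)) atTop (𝓝 0) :=
    squeeze_zero_norm (fun m => abs_rkLevel_sub_le m _ _) h2
  simpa using h3.add h1

end Completion

end Embeddings

/-! ### The odometer algebra and its `*`-regular closure -/

section Algebra

variable (n : ℕ → ℕ) [∀ i, (n i).AtLeastTwo] (K : Type*) [Field K]

/-- The action of `ℤ` on the algebra `C_K(X)` of locally constant functions that is induced by the
odometer: `k • f = f ∘ T^(-k)`, so that the characteristic function of `U` is sent to that of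
`T^k(U)`. -/
instance : MulSemiringAction (Multiplicative ℤ) (LocallyConstant (Space n) K) where
  smul k f := f.comap ⟨T n ^ (-k.toAdd), (T n ^ (-k.toAdd)).continuous⟩
  one_smul f := rfl
  mul_smul k l f := by
    ext x
    change f ((T n ^ (-(k.toAdd + l.toAdd))) x) = f ((T n ^ (-l.toAdd)) ((T n ^ (-k.toAdd)) x))
    rw [neg_add_rev, _root_.zpow_add, Homeomorph.mul_apply]
  smul_zero k := rfl
  smul_add k f g := rfl
  smul_one k := rfl
  smul_mul k f g := rfl

variable {n K} in
theorem smul_fun_apply (k : Multiplicative ℤ) (f : LocallyConstant (Space n) K) (x : Space n) :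
    (k • f) x = f ((T n ^ (-k.toAdd)) x) := rfl

/-- The generalized odometer algebra `O(n) = C_K(X) ⋊_T ℤ`: the element `single (ofAdd k) f` is
`f t^k`, and `t f t⁻¹ = f ∘ T⁻¹`. -/
abbrev OdometerAlgebra : Type _ :=
  SkewMonoidAlgebra (LocallyConstant (Space n) K) (Multiplicative ℤ)

/-- At level `m`, a locally constant function `f` is sent to the diagonal matrix of its values on
the sets `T^i(E_m)`, `0 ≤ i < p_m` (it is constant on these sets if `m` is large); the value is read
off at the point `T^i(0, 0, …)`. -/
def diag : LocallyConstant (Space n) K →+* cauchy n K where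
  toFun f := ⟨fun m => diagonal fun i : Fin (p n m) => f ((T n ^ (i : ℕ)) (zero n)), fun ε hε => by
    obtain ⟨M, hM⟩ := exists_level f
    refine ⟨M, fun m l h hm => ?_⟩
    suffices hs : (diagonal fun i : Fin (p n l) => f ((T n ^ (i : ℕ)) (zero n))) =
        emb h (diagonal fun i : Fin (p n m) => f ((T n ^ (i : ℕ)) (zero n))) by
      simp only [hs, sub_self, rkElem_zero]; exact hε
    ext a b
    rw [emb_apply]
    by_cases hab : a = b
    · subst hab
      rw [if_pos rfl, diagonal_apply_eq, diagonal_apply_eq]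
      exact hM _ _ fun i hi => (T_pow_mod (hi.trans_le hm) _).symm
    · rw [diagonal_apply_ne _ hab]
      split_ifs with h1
      · rw [diagonal_apply_ne]
        intro h2
        have h3 : (a : ℕ) % p n m = b % p n m := Fin.ext_iff.1 h2
        exact hab (Fin.ext (by rw [← Nat.div_add_mod (a : ℕ) (p n m), h1, h3, Nat.div_add_mod]))
      · rfl⟩
  map_one' := Subtype.ext (funext fun _ => diagonal_one)
  map_zero' := Subtype.ext (funext fun _ => diagonal_zero)
  map_mul' f g := Subtype.ext (funext fun _ => (diagonal_mul_diagonal _ _).symm)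
  map_add' f g := Subtype.ext (funext fun _ => (diagonal_add _ _).symm)

/-- The matrix `e_{1,0} + e_{2,1} + ⋯ + e_{p_m - 1, p_m - 2}` in `M_{p_m}(K)`, which is the image
of `χ_{X ∖ E_m} t`. -/
def shiftMat (m : ℕ) : Mat n K m :=
  Matrix.of fun a b : Fin (p n m) => if (a : ℕ) = b + 1 then 1 else 0

theorem shiftMat_apply (m : ℕ) (a b : Fin (p n m)) :
    shiftMat n K m a b = if (a : ℕ) = b + 1 then 1 else 0 := rfl

theorem shiftMat_cauchy (ε : ℝ) (hε : ε > 0) : ∃ N, ∀ m l, ∀ h : m ≤ l, N ≤ m →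
    rkElem (shiftMat n K l - emb h (shiftMat n K m)) < ε := by
  obtain ⟨N, hN⟩ := (tendsto_inv_p (n := n)).eventually (gt_mem_nhds hε) |>.exists_forall_of_atTop
  refine ⟨N, fun m l h hm => lt_of_le_of_lt ?_ (hN m hm)⟩
  let s : Finset (Fin (p n l)) := Finset.univ.image fun q : Fin (p n l / p n m) =>
    blockEquiv h (q, ⟨0, p_pos m⟩)
  have hs : (s.card : ℝ) ≤ p n l / p n m := by
    have h1 : s.card ≤ (Finset.univ : Finset (Fin (p n l / p n m))).card := Finset.card_image_le
    rw [Finset.card_univ, Fintype.card_fin] at h1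
    rw [← Nat.cast_div (p_dvd h) (by exact_mod_cast (p_pos m).ne')]
    exact_mod_cast h1
  refine (rkElem_le_card _ s fun a ha b => ?_).trans ?_
  · have ha' : (a : ℕ) % p n m ≠ 0 := fun h0 => ha <| by
      refine Finset.mem_image.2 ⟨((blockEquiv h).symm a).1, Finset.mem_univ _, ?_⟩
      have : ((blockEquiv h).symm a).2 = ⟨0, p_pos m⟩ := Fin.ext h0
      rw [← this]; exact (blockEquiv h).apply_symm_apply a
    rw [Matrix.sub_apply, emb_apply]
    simp only [shiftMat_apply]
    have hp := p_pos (n := n) m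
    have e1 := Nat.div_add_mod (a : ℕ) (p n m)
    have e2 := Nat.div_add_mod (b : ℕ) (p n m)
    have e3 := Nat.mod_lt (a : ℕ) hp
    by_cases hab : (a : ℕ) = b + 1
    · have hd : ¬ p n m ∣ (b : ℕ) + 1 := fun hd => ha' (by rw [hab]; exact Nat.mod_eq_zero_of_dvd hd)
      have hq : (a : ℕ) / p n m = b / p n m := by rw [hab, Nat.succ_div_of_not_dvd hd]
      rw [if_pos hab, if_pos hq, if_pos (by rw [hq] at e1; omega), sub_self]
    · rw [if_neg hab]
      split_ifs with h1 h2
      · exact absurd (by rw [h1] at e1; omega) hab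
      · simp
      · simp
  · have h2 : (p n l : ℝ) ≠ 0 := by exact_mod_cast (p_pos l).ne'
    have h3 : (p n m : ℝ)⁻¹ = (p n l : ℝ)⁻¹ * (p n l / p n m) := by field_simp
    rw [h3]
    exact mul_le_mul_of_nonneg_left hs (by positivity)

/-- The Cauchy sequence of the images of `χ_{X ∖ E_m} t`. -/
def shift : cauchy n K := ⟨shiftMat n K, shiftMat_cauchy n K⟩

variable [StarRing K]

/-- Every matrix sequence with at most one nonzero row at each level is a null sequence. -/
theorem mem_null_of_row {x : cauchy n K} (r : ∀ m, Fin (p n m))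
    (h : ∀ m i j, i ≠ r m → x.1 m i j = 0) : x ∈ null n K := by
  refine squeeze_zero (fun m => rkElem_nonneg _) (fun m => ?_) (tendsto_inv_p (n := n))
  simpa using rkElem_le_card (x.1 m) {r m} fun i hi j => h m i j (by simpa using hi)

/-- The image `lim_m χ_{X ∖ E_m} t` of `t`, as a unit of the completion. -/
def tUnit : (Completion n K)ˣ where
  val := cls n K (shift n K)
  inv := star (cls n K (shift n K))
  val_inv := by
    rw [star_cls, ← map_mul, ← map_one (cls n K), cls_eq_iff]
    refine mem_null_of_row n K (fun m => ⟨0, p_pos m⟩) fun m i j hi => ?_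
    have hi0 : (i : ℕ) ≠ 0 := fun h => hi (Fin.ext h)
    have hlt : (i : ℕ) - 1 < p n m := by omega
    change (_ * _ - 1 : Mat n K m) i j = 0
    rw [Matrix.sub_apply, Matrix.mul_apply, Finset.sum_eq_single ⟨(i : ℕ) - 1, hlt⟩]
    · rw [star_apply]
      simp only [shift, conjTranspose_apply, shiftMat_apply, Matrix.one_apply, Fin.ext_iff]
      rw [if_pos (by omega)]
      by_cases hij : (i : ℕ) = j
      · rw [if_pos (by omega), if_pos hij]; simp
      · rw [if_neg (by omega), if_neg hij]; simp
    · intro c _ hc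
      have : (i : ℕ) ≠ c + 1 := fun h => hc (Fin.ext (by simp only; omega))
      simp [shift, shiftMat_apply, this]
    · simp
  inv_val := by
    rw [star_cls, ← map_mul, ← map_one (cls n K), cls_eq_iff]
    refine mem_null_of_row n K (fun m => ⟨p n m - 1, by have := p_pos (n := n) m; omega⟩)
      fun m i j hi => ?_
    have hi0 : (i : ℕ) ≠ p n m - 1 := fun h => hi (Fin.ext h)
    have hlt : (i : ℕ) + 1 < p n m := by omega
    change (_ * _ - 1 : Mat n K m) i j = 0
    rw [Matrix.sub_apply, Matrix.mul_apply, Finset.sum_eq_single ⟨(i : ℕ) + 1, hlt⟩]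
    · rw [star_apply]
      simp only [shift, conjTranspose_apply, shiftMat_apply, Matrix.one_apply, Fin.ext_iff]
      rw [if_pos trivial]
      by_cases hij : (i : ℕ) = j
      · rw [if_pos (by omega), if_pos hij]; simp
      · rw [if_neg (by omega), if_neg hij]; simp
    · intro c _ hc
      have : (c : ℕ) ≠ i + 1 := fun h => hc (Fin.ext h)
      rw [star_apply]
      simp [shift, shiftMat_apply, this]
    · simp

theorem shift_mul_diag (f : LocallyConstant (Space n) K) :
    shift n K * diag n K f = diag n K (Multiplicative.ofAdd (1 : ℤ) • f) * shift n K := by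
  refine Subtype.ext (funext fun m => ?_)
  change shiftMat n K m * diagonal _ = diagonal _ * shiftMat n K m
  ext a b
  rw [mul_diagonal, diagonal_mul, shiftMat_apply]
  split_ifs with h
  · rw [one_mul, mul_one, smul_fun_apply, h, pow_succ', toAdd_ofAdd, _root_.zpow_neg_one]
    rw [Homeomorph.mul_apply, Homeomorph.inv_apply, Homeomorph.symm_apply_apply]
  · simp

theorem tUnit_mul_diag (f : LocallyConstant (Space n) K) :
    (tUnit n K : Completion n K) * cls n K (diag n K f)
      = cls n K (diag n K (Multiplicative.ofAdd (1 : ℤ) • f)) * tUnit n K := by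
  change cls n K (shift n K) * _ = _ * cls n K (shift n K)
  rw [← map_mul, shift_mul_diag, map_mul]

theorem diag_mul_tUnit_zpow (k : Multiplicative ℤ) (f : LocallyConstant (Space n) K) :
    cls n K (diag n K (k • f)) * ((tUnit n K ^ k.toAdd : (Completion n K)ˣ) : Completion n K)
      = ((tUnit n K ^ k.toAdd : (Completion n K)ˣ) : Completion n K) * cls n K (diag n K f) := by
  obtain ⟨k, rfl⟩ := Multiplicative.ofAdd.surjective k
  rw [toAdd_ofAdd]
  induction k generalizing f with
  | zero =>
    rw [ofAdd_zero, one_smul, zpow_zero, Units.val_one, one_mul, mul_one]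
  | succ k ih =>
    rw [ofAdd_add, mul_smul, _root_.zpow_add, zpow_one, Units.val_mul, ← mul_assoc, ih, mul_assoc,
      mul_assoc, tUnit_mul_diag]
  | pred k ih =>
    have h := tUnit_mul_diag n K (Multiplicative.ofAdd (-1 : ℤ) • f)
    rw [← mul_smul, ← ofAdd_add, add_neg_cancel, ofAdd_zero, one_smul] at h
    have h' : cls n K (diag n K (Multiplicative.ofAdd (-1 : ℤ) • f)) * ↑(tUnit n K)⁻¹
        = ↑(tUnit n K)⁻¹ * cls n K (diag n K f) := by
      rw [Units.mul_inv_eq_iff_eq_mul, mul_assoc, ← h, ← mul_assoc, Units.inv_mul, one_mul]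
    rw [sub_eq_add_neg, ofAdd_add, mul_smul, _root_.zpow_add, _root_.zpow_neg_one, Units.val_mul, ← mul_assoc, ih,
      mul_assoc, mul_assoc, h']

/-- The homomorphism `π_rk` from the odometer algebra to the completion: it is the limit of the
level-`m` representations on `C_K(X)`, and `π_rk(t) = lim_m χ_{X ∖ E_m} t`. -/
def piRk : OdometerAlgebra n K →+* Completion n K :=
  SkewMonoidAlgebra.liftNCRingHom ((cls n K).comp (diag n K))
    ((Units.coeHom (Completion n K)).comp (zpowersHom _ (tUnit n K)))
    fun {f k} => diag_mul_tUnit_zpow n K k f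

theorem piRk_single (k : Multiplicative ℤ) (f : LocallyConstant (Space n) K) :
    piRk n K (SkewMonoidAlgebra.single k f)
      = cls n K (diag n K f) * ((tUnit n K ^ k.toAdd : (Completion n K)ˣ) : Completion n K) :=
  SkewMonoidAlgebra.liftNC_single _ _ _ _

/-- The pointwise involution of `C_K(X)`. -/
def conj (f : LocallyConstant (Space n) K) : LocallyConstant (Space n) K := f.map star

theorem smul_conj (k : Multiplicative ℤ) (f : LocallyConstant (Space n) K) :
    k • conj n K f = conj n K (k • f) := rfl

/-- The additive map that underlies the involution of the odometer algebra. -/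
def starAdd : OdometerAlgebra n K →+ OdometerAlgebra n K where
  toFun a := a.sum fun k f => SkewMonoidAlgebra.single k⁻¹ (k⁻¹ • conj n K f)
  map_zero' := by rw [SkewMonoidAlgebra.sum_zero_index]
  map_add' a b := by
    refine SkewMonoidAlgebra.sum_add_index' (fun k => ?_) fun k f g => ?_
    · have h : conj n K 0 = 0 := by ext x; exact star_zero K
      rw [h, smul_zero, SkewMonoidAlgebra.single_zero]
    · have h : conj n K (f + g) = conj n K f + conj n K g := by ext x; exact star_add _ _
      rw [h, smul_add, SkewMonoidAlgebra.single_add]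

theorem starAdd_single (k : Multiplicative ℤ) (f : LocallyConstant (Space n) K) :
    starAdd n K (SkewMonoidAlgebra.single k f)
      = SkewMonoidAlgebra.single k⁻¹ (k⁻¹ • conj n K f) := by
  refine SkewMonoidAlgebra.sum_single_index (N := OdometerAlgebra n K)
    (h := fun k f => SkewMonoidAlgebra.single k⁻¹ (k⁻¹ • conj n K f)) ?_
  have h : conj n K 0 = 0 := by ext x; exact star_zero K
  rw [h, smul_zero, SkewMonoidAlgebra.single_zero]

/-- The involution of the odometer algebra, `(f t^k)^* = t^(-k) f^*`. -/
instance : StarRing (OdometerAlgebra n K) where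
  star := starAdd n K
  star_involutive a := by
    change ((starAdd n K).comp (starAdd n K)) a = AddMonoidHom.id _ a
    congr 1
    refine SkewMonoidAlgebra.addHom_ext fun k f => ?_
    have h : conj n K (conj n K f) = f := by ext x; exact star_star _
    rw [AddMonoidHom.comp_apply, starAdd_single, starAdd_single, inv_inv, ← smul_conj,
      smul_inv_smul, h, AddMonoidHom.id_apply]
  star_add a b := map_add _ a b
  star_mul a b := by
    change starAdd n K (a * b) = starAdd n K b * starAdd n K a
    induction a using SkewMonoidAlgebra.induction_on with
    | zero => rw [zero_mul, map_zero, mul_zero]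
    | add a a' h h' => rw [add_mul, map_add, h, h', map_add, mul_add]
    | single k f =>
      induction b using SkewMonoidAlgebra.induction_on with
      | zero => rw [mul_zero, map_zero, zero_mul]
      | add b b' h h' => rw [mul_add, map_add, h, h', map_add, add_mul]
      | single l g =>
        have h : conj n K (f * k • g) = conj n K f * k • conj n K g := by
          ext x; exact (star_mul _ _).trans (mul_comm _ _)
        rw [SkewMonoidAlgebra.single_mul_single, starAdd_single, starAdd_single, starAdd_single,
          SkewMonoidAlgebra.single_mul_single, h, smul_mul', _root_.mul_inv_rev, smul_smul, smul_smul,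
          mul_comm (l⁻¹ • _), inv_mul_cancel_right]

theorem star_single (k : Multiplicative ℤ) (f : LocallyConstant (Space n) K) :
    star (SkewMonoidAlgebra.single k f : OdometerAlgebra n K)
      = SkewMonoidAlgebra.single k⁻¹ (k⁻¹ • conj n K f) := starAdd_single n K k f

/-- The homomorphism `π_rk` preserves the involutions. -/
theorem piRk_star (a : OdometerAlgebra n K) : piRk n K (star a) = star (piRk n K a) := by
  induction a using SkewMonoidAlgebra.induction_on with
  | zero => rw [star_zero, map_zero, star_zero]
  | add a b h h' => rw [star_add, map_add, map_add, star_add, h, h']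
  | single k f =>
    have h1 : star (diag n K f) = diag n K (conj n K f) :=
      Subtype.ext (funext fun m => diagonal_conjTranspose _)
    have h2 : ∀ k : ℤ, star ((tUnit n K ^ k : (Completion n K)ˣ) : Completion n K)
        = ((tUnit n K ^ (-k) : (Completion n K)ˣ) : Completion n K) := fun k => by
      have h3 : star (tUnit n K) = (tUnit n K)⁻¹ := Units.ext rfl
      rw [← Units.coe_star, star_zpow, h3, _root_.inv_zpow, ← _root_.zpow_neg]
    rw [star_single, piRk_single, piRk_single, star_mul, star_cls, h1, h2, ← toAdd_inv,
      diag_mul_tUnit_zpow]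

/-- A subring of a `*`-ring is `*`-regular if it is closed under the involution, von Neumann
regular, and its involution is proper. -/
def IsStarRegular {R : Type*} [Ring R] [StarRing R] (B : Subring R) : Prop :=
  (∀ x ∈ B, star x ∈ B) ∧ (∀ x ∈ B, ∃ z ∈ B, x * z * x = x) ∧ ∀ x ∈ B, star x * x = 0 → x = 0

/-- The `*`-regular closure of a subset `S`: the smallest `*`-regular (unital) subring that
contains `S`, that is, the intersection of all of them. -/
def starRegularClosure {R : Type*} [Ring R] [StarRing R] (S : Set R) : Subring R :=
  sInf {B | IsStarRegular B ∧ S ⊆ B}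

/-- The `*`-regular closure of the odometer algebra in the completion. -/
def regClosure : Subring (Completion n K) := starRegularClosure (Set.range (piRk n K))

variable {n K}

/-- The rank function of the odometer algebra. -/
def rkOdometer {k : ℕ} (A : Matrix (Fin k) (Fin k) (OdometerAlgebra n K)) : ℝ :=
  rkCompletion (A.map (piRk n K))

/-- The rank function of the `*`-regular closure of the odometer algebra. -/
def rkRegClosure {k : ℕ} (A : Matrix (Fin k) (Fin k) (regClosure n K)) : ℝ :=
  rkCompletion (A.map Subtype.val)

end Algebra

/-! ### Sets of ranks and Betti numbers, and the group of the supernatural number -/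

/-- The set of ranks of square matrices over `R`. -/
def rankValues {R : Type*} (rk : ∀ k : ℕ, Matrix (Fin k) (Fin k) R → ℝ) : Set ℝ :=
  {r | ∃ k : ℕ, 1 ≤ k ∧ ∃ A : Matrix (Fin k) (Fin k) R, r = rk k A}

/-- The set of Betti numbers `k - rk(A)` of `k × k` matrices `A` over `R`. -/
def bettiNumbers {R : Type*} (rk : ∀ k : ℕ, Matrix (Fin k) (Fin k) R → ℝ) : Set ℝ :=
  {r | ∃ k : ℕ, 1 ≤ k ∧ ∃ A : Matrix (Fin k) (Fin k) R, r = k - rk k A}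

/-- The exponent of the prime `q` in the supernatural number `∏ i, n i`: the sum of the exponents of
`q` in the `n i`. -/
def exponent (n : ℕ → ℕ) (q : ℕ) : ℕ∞ :=
  ⨆ r : ℕ, ((∑ i ∈ Finset.range r, (n i).factorization q : ℕ) : ℕ∞)

section Supernatural

variable (n : ℕ → ℕ) [∀ i, (n i).AtLeastTwo]

theorem le_exponent_iff {b : ℕ} (hb : b ≠ 0) :
    (∀ q, q.Prime → (b.factorization q : ℕ∞) ≤ exponent n q) ↔ ∃ r, b ∣ p n r := by
  have hf : ∀ r q, (p n r).factorization q = ∑ i ∈ Finset.range r, (n i).factorization q :=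
    fun r q => by
      rw [p, Nat.factorization_prod fun i _ => (NeZero.ne (n i)), Finsupp.finsetSum_apply]
  constructor
  · intro h
    have h1 : ∀ q, ∃ r, q.Prime → b.factorization q ≤ (p n r).factorization q := fun q => by
      by_contra! hc
      have hq := h q (hc 0).1
      have h0 := (hc 0).2
      have h2 : exponent n q ≤ ((b.factorization q - 1 : ℕ) : ℕ∞) := iSup_le fun r => by
        have := (hc r).2
        rw [hf] at this
        exact_mod_cast (by omega)
      have h3 : b.factorization q ≤ b.factorization q - 1 := by exact_mod_cast hq.trans h2
      omega
    choose r hr using h1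
    refine ⟨b.primeFactors.sup r, (Nat.factorization_prime_le_iff_dvd hb (p_pos _).ne').1 ?_⟩
    intro q hq
    by_cases hqb : q ∈ b.primeFactors
    · exact (hr q hq).trans ((Nat.factorization_le_iff_dvd (p_pos _).ne' (p_pos _).ne').2
        (p_dvd (Finset.le_sup hqb)) q)
    · rw [Finsupp.notMem_support_iff.1 (by simpa using hqb)]; exact Nat.zero_le _
  · rintro ⟨r, hr⟩ q -
    refine le_trans ?_ (le_iSup _ r)
    rw [← hf]
    exact_mod_cast (Nat.factorization_le_iff_dvd hb (p_pos _).ne').2 hr q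

/-- The group `Z(n)` of the fractions `a / b` for which the exponent of every prime in the positive
integer `b` is at most its exponent in the supernatural number `∏ i, n i`. -/
def Z : AddSubgroup ℚ where
  carrier := {x | ∃ (a : ℤ) (b : ℕ), b ≠ 0 ∧
    (∀ q, q.Prime → (b.factorization q : ℕ∞) ≤ exponent n q) ∧ x = a / b}
  zero_mem' := ⟨0, 1, by simp, by simp, by simp⟩
  add_mem' := by
    rintro _ _ ⟨a, b, hb, h, rfl⟩ ⟨c, d, hd, h', rfl⟩
    obtain ⟨r, hr⟩ := (le_exponent_iff n hb).1 h
    obtain ⟨s, hs⟩ := (le_exponent_iff n hd).1 h'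
    have hl : Nat.lcm b d ≠ 0 := Nat.lcm_ne_zero hb hd
    obtain ⟨u, hu⟩ := Nat.dvd_lcm_left b d
    obtain ⟨v, hv⟩ := Nat.dvd_lcm_right b d
    refine ⟨a * u + c * v, Nat.lcm b d, hl,
      (le_exponent_iff n hl).2 ⟨max r s, Nat.lcm_dvd (hr.trans (p_dvd (le_max_left _ _)))
        (hs.trans (p_dvd (le_max_right _ _)))⟩, ?_⟩
    have hb' : (b : ℚ) ≠ 0 := by exact_mod_cast hb
    have hd' : (d : ℚ) ≠ 0 := by exact_mod_cast hd
    have hl' : (Nat.lcm b d : ℚ) ≠ 0 := by exact_mod_cast hl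
    have hu' : (Nat.lcm b d : ℚ) = b * u := by exact_mod_cast hu
    have hv' : (Nat.lcm b d : ℚ) = d * v := by exact_mod_cast hv
    rw [eq_div_iff hl', add_mul]
    nth_rewrite 1 [hu']
    rw [hv']
    push_cast
    field_simp
  neg_mem' := by
    rintro _ ⟨a, b, hb, h, rfl⟩
    exact ⟨-a, b, hb, h, by push_cast; ring⟩

/-- `Z(n)` consists of the fractions `a / (n_1 ⋯ n_r)`. -/
theorem mem_Z {x : ℚ} : x ∈ Z n ↔ ∃ (a : ℤ) (r : ℕ), x = a / p n r := by
  constructor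
  · rintro ⟨a, b, hb, h, rfl⟩
    obtain ⟨r, c, hc⟩ := (le_exponent_iff n hb).1 h
    refine ⟨a * c, r, ?_⟩
    have h1 : (p n r : ℚ) ≠ 0 := by exact_mod_cast (p_pos r).ne'
    have hb' : (b : ℚ) ≠ 0 := by exact_mod_cast hb
    rw [div_eq_div_iff hb' h1, hc]
    push_cast; ring
  · rintro ⟨a, r, rfl⟩
    exact ⟨a, p n r, (p_pos r).ne', (le_exponent_iff n (p_pos r).ne').2 ⟨r, dvd_rfl⟩, rfl⟩

/-- `Z(n)` as a subgroup of the real numbers. -/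
def ZReal : AddSubgroup ℝ := (Z n).map (Rat.castHom ℝ).toAddMonoidHom

/-- The set `Z(n)⁺` of the nonnegative elements of `Z(n)`. -/
def ZPos : Set ℝ := {x | x ∈ ZReal n ∧ 0 ≤ x}

end Supernatural

end

end Odometer

/-!
The arithmetic of the ranks comes from a description of a `*`-regular ring that contains the
`*`-regular closure. At the level `m` the sets `T^i(E_m)`, `0 ≤ i < p_m`, partition `X` and are
permuted cyclically by `T`, so the elements `e_{ij} = χ_{T^i(E_m)} t^(i-j)` form a system of matrix
units (`matUnit`). The power `t ^ p_m` commutes with them, and the functions of the first `m` digits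
together with the powers of `t` generate a copy of `M_{p_m}(K[t^{p_m}, t^{-p_m}])`; these algebras
exhaust the odometer algebra.

In the completion every nonzero polynomial in `t` is invertible (`isUnit_polyHom`): the element `t`
is the limit of nilpotent shift matrices, at which a polynomial with nonzero constant term takes
invertible values, and the inverses form a Cauchy sequence (`isUnit_cls`). Hence the inclusion
extends to a homomorphism `levelHom` from `M_{p_m}(K(x))`, for an indeterminate `x`, to the
completion that takes `x` to `t ^ p_m`. Its images `levelRing m` increase with `m` and are von
Neumann regular and closed under the involution.

The involution of the completion is proper, because `xᴴ x` and `x` have the same rank when the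
involution of `K` is positive definite (`eq_zero_of_star_mul_self`). So the union `limitRing` of the
`levelRing m` is `*`-regular and contains the `*`-regular closure.

A matrix over `levelRing m` comes from a matrix over the field `K(x)`. By Gaussian elimination it is
equivalent to a diagonal matrix of characteristic functions, whose rank is an integer divided by
`p_m` (`exists_rkCompletion_eq`, `rkCompletion_diagonal`). Conversely all the fractions
`c / p_m ≤ k` are ranks of such diagonal `k × k` matrices (`exists_rkOdometer_eq`).
-/

namespace Odometer

noncomputable section

set_option linter.unusedSectionVars false

open Filter Topology Matrix Polynomial

/-! ### Rings, matrices and fractions -/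

section General

/-- Matrix rings over a field are von Neumann regular. -/
theorem exists_mul_mul_eq_self {ι F : Type*} [Fintype ι] [DecidableEq ι] [Field F]
    (A : Matrix ι ι F) : ∃ Z, A * Z * A = A := by
  obtain ⟨V, U, w, ⟨V, rfl⟩, ⟨U, rfl⟩, h, hw⟩ := exists_units_mul_eq_diagonal A
  refine ⟨U * V, ?_⟩
  have h1 : diagonal w * diagonal w = diagonal w := by
    rw [diagonal_mul_diagonal]
    congr 1
    funext i
    rcases hw i with h | h <;> simp [h]
  rw [← h] at h1
  have h2 : (V : Matrix ι ι F) * (A * (U * V) * A) * U = V * A * U := by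
    rw [← h1]; simp only [mul_assoc]
  exact V.isUnit.mul_left_cancel (U.isUnit.mul_right_cancel h2)

/-- A von Neumann regular subring contains the inverses of its elements. -/
theorem inv_mem_of_regular {R : Type*} [Ring R] {B : Subring R}
    (hB : ∀ x ∈ B, ∃ z ∈ B, x * z * x = x) {u : Rˣ} (hu : (u : R) ∈ B) : ((u⁻¹ : Rˣ) : R) ∈ B := by
  obtain ⟨z, hz, h⟩ := hB _ hu
  have h1 : (u : R) * z = 1 := u.isUnit.mul_right_cancel (by rw [h, one_mul])
  rwa [Units.inv_eq_of_mul_eq_one_right h1]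

/-- A homomorphism from a domain to a possibly noncommutative ring that takes nonzero elements to
units extends to the field of fractions. -/
theorem exists_fractionRing_hom {A R : Type*} [CommRing A] [IsDomain A] [Ring R] (f : A →+* R)
    (hf : ∀ a, a ≠ 0 → IsUnit (f a)) :
    ∃ g : FractionRing A →+* R, ∀ a, g (algebraMap A (FractionRing A) a) = f a := by
  let fS : nonZeroDivisors A →* Rˣ := IsUnit.liftRight (f.toMonoidHom.comp (nonZeroDivisors A).subtype)
    fun s => hf s (nonZeroDivisors.ne_zero s.2)
  exact ⟨OreLocalization.universalHom f fS fun s => rfl,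
    fun a => OreLocalization.universalHom_commutes f fS fun s => rfl⟩

/-- A homomorphism `ψ : F → R` and a system of matrix units in `R` that commutes with the image of
`ψ` combine to a homomorphism from the matrices over `F` to `R`. -/
def matrixHom {ι F R : Type*} [Fintype ι] [DecidableEq ι] [Semiring F] [Semiring R] (ψ : F →+* R)
    (e : ι → ι → R) (h1 : ∑ i, e i i = 1)
    (hmul : ∀ i j k l, e i j * e k l = if j = k then e i l else 0)
    (hcomm : ∀ a i j, Commute (ψ a) (e i j)) : Matrix ι ι F →+* R where
  toFun A := ∑ i, ∑ j, ψ (A i j) * e i j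
  map_one' := by
    rw [← h1]
    refine Finset.sum_congr rfl fun i _ => ?_
    rw [Finset.sum_eq_single i (fun j _ hj => by simp [one_apply_ne hj.symm]) (by simp)]
    simp
  map_zero' := by simp
  map_add' A B := by simp [add_mul, Finset.sum_add_distrib]
  map_mul' A B := by
    change ∑ i, ∑ j, ψ ((A * B) i j) * e i j
      = (∑ i, ∑ j, ψ (A i j) * e i j) * ∑ i, ∑ j, ψ (B i j) * e i j
    have h : ∀ i j k l, ψ (A i j) * e i j * (ψ (B k l) * e k l) =
        if j = k then ψ (A i j * B k l) * e i l else 0 := fun i j k l => by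
      rw [mul_assoc, ← mul_assoc (e i j), ← (hcomm (B k l) i j).eq, mul_assoc (ψ _), hmul,
        map_mul]
      split_ifs <;> simp [mul_assoc]
    have h2 : ∀ i j, ψ (A i j) * e i j * (∑ k, ∑ l, ψ (B k l) * e k l)
        = ∑ l, ψ (A i j * B j l) * e i l := fun i j => by
      rw [Finset.mul_sum, Finset.sum_eq_single j]
      · rw [Finset.mul_sum]
        exact Finset.sum_congr rfl fun l _ => (h i j j l).trans (if_pos rfl)
      · intro k _ hk
        rw [Finset.mul_sum]
        exact Finset.sum_eq_zero fun l _ => (h i j k l).trans (if_neg hk.symm)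
      · simp
    rw [Finset.sum_mul]
    refine Finset.sum_congr rfl fun i _ => ?_
    rw [Finset.sum_mul, Finset.sum_congr rfl fun j _ => h2 i j, Finset.sum_comm]
    refine Finset.sum_congr rfl fun l _ => ?_
    rw [Matrix.mul_apply, map_sum, Finset.sum_mul]

theorem matrixHom_apply {ι F R : Type*} [Fintype ι] [DecidableEq ι] [Semiring F] [Semiring R]
    (ψ : F →+* R) (e : ι → ι → R) (h1 : ∑ i, e i i = 1)
    (hmul : ∀ i j k l, e i j * e k l = if j = k then e i l else 0)
    (hcomm : ∀ a i j, Commute (ψ a) (e i j)) (A : Matrix ι ι F) :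
    matrixHom ψ e h1 hmul hcomm A = ∑ i, ∑ j, ψ (A i j) * e i j := rfl

end General

/-! ### The address of a point in the tower of height `p_m` -/

section Address

variable {n : ℕ → ℕ} [∀ i, (n i).AtLeastTwo]

/-- The number `∑ i < m, x_i p_i` whose mixed-radix digits are the first `m` digits of `x`. -/
def address (m : ℕ) (x : Space n) : ℕ := ∑ i ∈ Finset.range m, (x i : ℕ) * p n i

theorem address_succ (m : ℕ) (x : Space n) :
    address (m + 1) x = address m x + x m * p n m := Finset.sum_range_succ _ _

theorem address_lt (m : ℕ) (x : Space n) : address m x < p n m := by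
  induction m with
  | zero => simp [address, p]
  | succ m ih =>
    have h := (x m).isLt
    rw [address_succ, p_succ]
    nlinarith

theorem eq_of_address_eq {m : ℕ} {x x' : Space n} (h : address m x = address m x') :
    ∀ i < m, x i = x' i := by
  induction m with
  | zero => simp
  | succ m ih =>
    rw [address_succ, address_succ] at h
    have hx := address_lt m x
    have hx' := address_lt m x'
    have h1 : address m x = address m x' := by
      have := congrArg (· % p n m) h
      simpa [Nat.mod_eq_of_lt hx, Nat.mod_eq_of_lt hx'] using this
    intro i hi
    rcases Nat.lt_succ_iff_lt_or_eq.1 hi with hi | rfl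
    · exact ih h1 i hi
    · rw [h1, add_right_inj] at h
      exact Fin.ext (Nat.eq_of_mul_eq_mul_right (p_pos i) h)

open Classical in
/-- Adding one raises the address by one, up to a carry out of the first `m` digits. -/
theorem address_addOne (m : ℕ) (x : Space n) :
    address m (addOne n x) + (if ∀ j < m, (x j : ℕ) + 1 = n j then p n m else 0)
      = address m x + 1 := by
  induction m with
  | zero => simp [address, p]
  | succ m ih =>
    rw [address_succ, address_succ]
    by_cases h : ∀ j < m, (x j : ℕ) + 1 = n j
    · rw [if_pos h] at ih
      have h1 : addOne n x m = x m + 1 := by rw [addOne, if_pos h]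
      by_cases h2 : (x m : ℕ) + 1 = n m
      · have h3 : ∀ j < m + 1, (x j : ℕ) + 1 = n j := fun j hj => by
          rcases Nat.lt_succ_iff_lt_or_eq.1 hj with hj | rfl
          exacts [h j hj, h2]
        have h4 : (p n m * n m : ℕ) = p n m * (x m + 1) := by rw [h2]
        rw [if_pos h3, h1, (val_add_one_eq_zero_iff _).2 h2, p_succ, h4]
        linarith
      · have h3 : ¬ ∀ j < m + 1, (x j : ℕ) + 1 = n j := fun h3 => h2 (h3 m (Nat.lt_succ_self m))
        have h4 : ((x m + 1 : Fin (n m)) : ℕ) = x m + 1 := by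
          have h5 := two_le (n := n) m
          have h6 := (x m).isLt
          rw [Fin.val_add, Fin.val_one', Nat.mod_eq_of_lt h5, Nat.mod_eq_of_lt (by omega)]
        rw [if_neg h3, h1, h4]
        linarith
    · have h3 : ¬ ∀ j < m + 1, (x j : ℕ) + 1 = n j :=
        fun h3 => h fun j hj => h3 j (hj.trans (Nat.lt_succ_self m))
      rw [if_neg h] at ih
      rw [if_neg h3, addOne, if_neg h]
      linarith

/-- The address modulo `p_m`: the sets `T^i(E_m)` are its fibres. -/
def residue (m : ℕ) : LocallyConstant (Space n) (ZMod (p n m)) :=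
  LocallyConstant.map (fun a : ℕ => (a : ZMod (p n m)))
    ⟨address m, (IsLocallyConstant.iff_continuous _).2 <| continuous_finsetSum _ fun i _ =>
      (continuous_of_discreteTopology (f := fun a : Fin (n i) => (a : ℕ) * p n i)).comp
        (continuous_apply i)⟩

theorem residue_apply (m : ℕ) (x : Space n) : residue m x = (address m x : ZMod (p n m)) := rfl

theorem val_residue (m : ℕ) (x : Space n) : (residue m x).val = address m x :=
  ZMod.val_cast_of_lt (address_lt m x)

theorem residue_T (m : ℕ) (x : Space n) : residue m (T n x) = residue m x + 1 := by
  classical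
  have h := congrArg (Nat.cast : ℕ → ZMod (p n m)) (address_addOne m x)
  rw [Nat.cast_add, Nat.cast_add, Nat.cast_one] at h
  rw [residue_apply, residue_apply, ← h, apply_ite (Nat.cast : ℕ → ZMod (p n m))]
  simp [T]

theorem residue_zpow (m : ℕ) (k : ℤ) (x : Space n) :
    residue m ((T n ^ k) x) = residue m x + k := by
  induction k with
  | zero => simp
  | succ k ih =>
    rw [add_comm, _root_.zpow_add, zpow_one, Homeomorph.mul_apply, residue_T, ih]
    push_cast; ring
  | pred k ih =>
    have h : T n ((T n ^ (-(k : ℤ) - 1)) x) = (T n ^ (-(k : ℤ))) x := by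
      rw [← Homeomorph.mul_apply, ← _root_.zpow_one_add]
      congr 2; ring
    rw [← h, residue_T] at ih
    rw [eq_sub_of_add_eq ih]
    push_cast; ring

theorem residue_pow_zero (m i : ℕ) : residue m ((T n ^ i) (zero n)) = (i : ZMod (p n m)) := by
  have h := residue_zpow m i (zero n)
  rw [zpow_natCast] at h
  rw [h, residue_apply]
  simp [address, zero]

theorem eq_of_residue_eq {m : ℕ} {x x' : Space n} (h : residue m x = residue m x') :
    ∀ i < m, x i = x' i :=
  eq_of_address_eq (by rw [← val_residue, h, val_residue])

/-- A locally constant function is a function of the address at some level. -/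
theorem exists_comp_residue {Y : Type*} (f : LocallyConstant (Space n) Y) :
    ∃ m, ∀ l, m ≤ l → ∃ g : ZMod (p n l) → Y, f = (residue l).map g := by
  obtain ⟨m, hm⟩ := exists_level f
  refine ⟨m, fun l hl => ⟨fun a => f ((T n ^ a.val) (zero n)), ?_⟩⟩
  ext x
  refine hm _ _ fun i hi => eq_of_residue_eq ?_ i (hi.trans_le hl)
  rw [residue_pow_zero, ZMod.natCast_zmod_val]

/-- The address at level `m` is a function of the address at a higher level. -/
theorem exists_residue_eq {m l : ℕ} (h : m ≤ l) {Y : Type*} (g : ZMod (p n m) → Y) :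
    ∃ g' : ZMod (p n l) → Y, (residue m).map g = (residue (n := n) l).map g' := by
  refine ⟨fun a => g (residue m ((T n ^ a.val) (zero n))), ?_⟩
  ext x
  refine congrArg g ?_
  have h1 : ∀ i < l, x i = ((T n ^ (residue l x).val) (zero n)) i := eq_of_residue_eq <| by
    rw [residue_pow_zero, ZMod.natCast_zmod_val]
  rw [residue_apply, residue_apply]
  congr 1
  exact Finset.sum_congr rfl fun i hi => by rw [h1 i ((Finset.mem_range.1 hi).trans_le h)]

end Address

/-! ### Ranks of matrices over the completion -/

section CompletionRank

/-- A real function on a monoid that does not increase under multiplication from either side is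
invariant under multiplication by units. -/
theorem eq_of_units_mul {M : Type*} [Monoid M] (rk : M → ℝ) (hl : ∀ a b, rk (a * b) ≤ rk a)
    (hr : ∀ a b, rk (a * b) ≤ rk b) {v a u : M} (hv : IsUnit v) (hu : IsUnit u) :
    rk (v * a * u) = rk a := by
  obtain ⟨v, rfl⟩ := hv
  obtain ⟨u, rfl⟩ := hu
  refine le_antisymm ((hl _ _).trans (hr _ _)) ?_
  calc rk a = rk (↑v⁻¹ * (↑v * a * ↑u) * ↑u⁻¹) := by simp [mul_assoc]
    _ ≤ _ := (hl _ _).trans (hr _ _)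

variable {n : ℕ → ℕ} [∀ i, (n i).AtLeastTwo] {K : Type*} [Field K]

theorem rkLevel_mul_le_left (m : ℕ) {k : ℕ} (A B : Matrix (Fin k) (Fin k) (Mat n K m)) :
    rkLevel n m (A * B) ≤ rkLevel n m A := by
  have h : Matrix.comp _ _ _ _ K (A * B) = Matrix.comp _ _ _ _ K A * Matrix.comp _ _ _ _ K B :=
    map_mul (compRingEquiv (Fin k) (Fin (p n m)) K) A B
  rw [rkLevel, rkLevel, h]
  exact mul_le_mul_of_nonneg_left (by exact_mod_cast rank_mul_le_left _ _) ENNReal.toReal_nonneg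

theorem rkLevel_mul_le_right (m : ℕ) {k : ℕ} (A B : Matrix (Fin k) (Fin k) (Mat n K m)) :
    rkLevel n m (A * B) ≤ rkLevel n m B := by
  have h : Matrix.comp _ _ _ _ K (A * B) = Matrix.comp _ _ _ _ K A * Matrix.comp _ _ _ _ K B :=
    map_mul (compRingEquiv (Fin k) (Fin (p n m)) K) A B
  rw [rkLevel, rkLevel, h]
  exact mul_le_mul_of_nonneg_left (by exact_mod_cast rank_mul_le_right _ _) ENNReal.toReal_nonneg

theorem rkLevel_le (m : ℕ) {k : ℕ} (A : Matrix (Fin k) (Fin k) (Mat n K m)) :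
    rkLevel n m A ≤ k := by
  have h : (Matrix.comp _ _ _ _ K A).rank ≤ k * p n m := by
    simpa using rank_le_card_width (Matrix.comp _ _ _ _ K A)
  have hp : (0 : ℝ) < p n m := by exact_mod_cast p_pos m
  rw [rkLevel, mu_E, inv_mul_le_iff₀ hp, mul_comm]
  exact_mod_cast h

/-- Evaluation of Cauchy sequences at the level `m`. -/
def evalLevel (n : ℕ → ℕ) [∀ i, (n i).AtLeastTwo] (K : Type*) [Field K] (m : ℕ) :
    cauchy n K →+* Mat n K m := (Pi.evalRingHom _ m).comp (cauchy n K).subtype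

theorem exists_map_cls {k : ℕ} (A : Matrix (Fin k) (Fin k) (Completion n K)) :
    ∃ B : Matrix (Fin k) (Fin k) (cauchy n K), A = B.map (cls n K) :=
  ⟨A.map (rep n K), by ext i j; exact (cls_rep _).symm⟩

theorem rkCompletion_mul_le_left {k : ℕ} (A B : Matrix (Fin k) (Fin k) (Completion n K)) :
    rkCompletion (A * B) ≤ rkCompletion A := by
  obtain ⟨A, rfl⟩ := exists_map_cls A
  obtain ⟨B, rfl⟩ := exists_map_cls B
  have h0 : (A * B).map (cls n K) = A.map (cls n K) * B.map (cls n K) := Matrix.map_mul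
  rw [← h0]
  refine le_of_tendsto_of_tendsto' (tendsto_rkLevel _) (tendsto_rkLevel _) fun m => ?_
  have h : (A * B).map (evalLevel n K m) = A.map (evalLevel n K m) * B.map (evalLevel n K m) :=
    Matrix.map_mul
  exact (congrArg (rkLevel n m) h).trans_le (rkLevel_mul_le_left m _ _)

theorem rkCompletion_mul_le_right {k : ℕ} (A B : Matrix (Fin k) (Fin k) (Completion n K)) :
    rkCompletion (A * B) ≤ rkCompletion B := by
  obtain ⟨A, rfl⟩ := exists_map_cls A
  obtain ⟨B, rfl⟩ := exists_map_cls B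
  have h0 : (A * B).map (cls n K) = A.map (cls n K) * B.map (cls n K) := Matrix.map_mul
  rw [← h0]
  refine le_of_tendsto_of_tendsto' (tendsto_rkLevel _) (tendsto_rkLevel _) fun m => ?_
  have h : (A * B).map (evalLevel n K m) = A.map (evalLevel n K m) * B.map (evalLevel n K m) :=
    Matrix.map_mul
  exact (congrArg (rkLevel n m) h).trans_le (rkLevel_mul_le_right m _ _)

theorem rkCompletion_le {k : ℕ} (A : Matrix (Fin k) (Fin k) (Completion n K)) :
    rkCompletion A ≤ k := by
  obtain ⟨A, rfl⟩ := exists_map_cls A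
  exact le_of_tendsto' (tendsto_rkLevel _) fun m => rkLevel_le m _

theorem rkCompletion_units_mul {k : ℕ} {V A U : Matrix (Fin k) (Fin k) (Completion n K)}
    (hV : IsUnit V) (hU : IsUnit U) : rkCompletion (V * A * U) = rkCompletion A :=
  eq_of_units_mul rkCompletion rkCompletion_mul_le_left rkCompletion_mul_le_right hV hU

/-- The value of the diagonal sequence of a function of the address modulo `p_m` at a level `l ≥ m`
is the image of its value at the level `m`. -/
theorem diag_residue_level {m l : ℕ} (h : m ≤ l) (g : ZMod (p n m) → K) :
    (diag n K ((residue m).map g)).1 l = emb h (diagonal fun i : Fin (p n m) => g (i : ℕ)) := by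
  ext a b
  change (diagonal fun i : Fin (p n l) => g (residue m ((T n ^ (i : ℕ)) (zero n)))) a b = _
  rw [emb_apply]
  by_cases hab : a = b
  · subst hab
    rw [if_pos rfl, diagonal_apply_eq, diagonal_apply_eq, residue_pow_zero]
    simp
  · rw [diagonal_apply_ne _ hab]
    split_ifs with h1
    · rw [diagonal_apply_ne]
      intro h2
      have h3 : (a : ℕ) % p n m = b % p n m := Fin.ext_iff.1 h2
      exact hab (Fin.ext (by rw [← Nat.div_add_mod (a : ℕ) (p n m), h1, h3, Nat.div_add_mod]))
    · rfl

/-- The rank of a diagonal matrix over `C_K(X)` is the sum of the measures of the supports of its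
entries. -/
theorem rkCompletion_diagonal (m : ℕ) {k : ℕ} (g : Fin k → ZMod (p n m) → K) :
    rkCompletion (diagonal fun i => cls n K (diag n K ((residue m).map (g i))))
      = Nat.card {ij : Fin k × Fin (p n m) // g ij.1 (ij.2 : ℕ) ≠ 0} / p n m := by
  classical
  have h1 := tendsto_rkLevel (diagonal fun i => diag n K ((residue m).map (g i)))
  rw [diagonal_map (map_zero _)] at h1
  refine tendsto_nhds_unique h1 (tendsto_const_nhds.congr' ?_)
  filter_upwards [eventually_ge_atTop m] with l hl
  have h2 : (diagonal fun i => diag n K ((residue m).map (g i))).map (fun x => x.1 l)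
      = (diagonal fun i => diagonal fun j : Fin (p n m) => g i (j : ℕ)).map (emb hl) := by
    rw [diagonal_map rfl, diagonal_map (map_zero _)]
    congr 1
    funext i
    exact diag_residue_level hl (g i)
  rw [h2, rkLevel_emb, rkLevel, mu_E, comp_diagonal_diagonal, rank_diagonal,
    Nat.card_eq_fintype_card, div_eq_inv_mul]

end CompletionRank

/-! ### Units and the involution of the completion -/

section CompletionUnits

variable {n : ℕ → ℕ} [∀ i, (n i).AtLeastTwo] {K : Type*} [Field K]

/-- A Cauchy sequence of invertible matrices represents a unit of the completion. -/
theorem isUnit_cls {x : cauchy n K} (hx : ∀ m, IsUnit (x.1 m)) : IsUnit (cls n K x) := by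
  choose u hu using hx
  let y : cauchy n K := ⟨fun m => ((u m)⁻¹ : (Mat n K m)ˣ), fun ε hε => by
    obtain ⟨N, hN⟩ := x.2 ε hε
    refine ⟨N, fun m l h hm => lt_of_le_of_lt ?_ (hN m l h hm)⟩
    -- `x_l⁻¹ - x_m⁻¹ = -x_l⁻¹ (x_l - x_m) x_m⁻¹`, so the inverses are as close as the `x_m`
    have h1 : (((u l)⁻¹ : (Mat n K l)ˣ) : Mat n K l) - emb h (((u m)⁻¹ : (Mat n K m)ˣ) : Mat n K m)
        = ((u l)⁻¹ : (Mat n K l)ˣ) * -(x.1 l - emb h (x.1 m))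
          * emb h (((u m)⁻¹ : (Mat n K m)ˣ) : Mat n K m) := by
      rw [← hu, ← hu, neg_sub, mul_sub, sub_mul, mul_assoc, ← map_mul, Units.mul_inv, map_one,
        Units.inv_mul, mul_one, one_mul]
    rw [h1]
    refine (rkElem_mul_le_left _ _).trans ((rkElem_mul_le_right _ _).trans ?_)
    rw [rkElem_neg]⟩
  have h1 : x * y = 1 := Subtype.ext <| funext fun m => by
    change x.1 m * ((u m)⁻¹ : (Mat n K m)ˣ) = 1
    rw [← hu, Units.mul_inv]
  have h2 : y * x = 1 := Subtype.ext <| funext fun m => by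
    change ((u m)⁻¹ : (Mat n K m)ˣ) * x.1 m = 1
    rw [← hu, Units.inv_mul]
  exact IsUnit.map (cls n K) ⟨⟨x, y, h1, h2⟩, rfl⟩

theorem shiftMat_pow_apply (m k : ℕ) (a b : Fin (p n m)) :
    (shiftMat n K m ^ k) a b = if (a : ℕ) = b + k then 1 else 0 := by
  induction k generalizing a b with
  | zero => simp [Matrix.one_apply, Fin.ext_iff]
  | succ k ih =>
    rw [pow_succ, Matrix.mul_apply]
    simp only [ih, shiftMat_apply]
    by_cases h : (b : ℕ) + 1 < p n m
    · rw [Finset.sum_eq_single ⟨b + 1, h⟩]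
      · simp only [if_true, mul_one]
        congr 1
        apply propext; omega
      · intro c _ hc
        have : (c : ℕ) ≠ b + 1 := fun h => hc (Fin.ext h)
        simp [this]
      · simp
    · have h1 : (a : ℕ) ≠ b + (k + 1) := by omega
      rw [if_neg h1]
      refine Finset.sum_eq_zero fun c _ => ?_
      have : (c : ℕ) ≠ b + 1 := by omega
      simp [this]

/-- Polynomials with nonzero constant term are invertible at the nilpotent matrix `shiftMat`. -/
theorem isUnit_aeval_shiftMat (m : ℕ) {q : K[X]} (hq : ¬ X ∣ q) :
    IsUnit (aeval (shiftMat n K m) q) := by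
  have h0 : shiftMat n K m ^ p n m = 0 := by
    ext a b
    have : (a : ℕ) ≠ b + p n m := by omega
    rw [shiftMat_pow_apply, if_neg this]; rfl
  have h1 : IsCoprime (X ^ p n m) q :=
    ((Polynomial.irreducible_X.coprime_iff_not_dvd).2 hq).pow_left
  obtain ⟨a, b, h⟩ := h1
  have h2 : aeval (shiftMat n K m) (b * q) = 1 := by
    have := congrArg (aeval (shiftMat n K m)) h
    rwa [map_add, map_mul, map_pow, aeval_X, h0, mul_zero, zero_add, map_one] at this
  have h3 := h2
  rw [mul_comm, map_mul] at h3
  rw [map_mul] at h2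
  exact ⟨⟨_, _, h3, h2⟩, rfl⟩

variable [StarRing K]

/-- The involution of the completion is proper: if the involution of `K` is positive definite, then
`xᴴ * x` and `x` have the same kernel, hence the same rank, for every matrix `x` over `K`. -/
theorem eq_zero_of_star_mul_self
    (hK : ∀ (r : ℕ) (a : Fin r → K), ∑ i, star (a i) * a i = 0 → ∀ i, a i = 0)
    {a : Completion n K} (h : star a * a = 0) : a = 0 := by
  have hrank : ∀ (m : ℕ) (x : Mat n K m), (xᴴ * x).rank = x.rank := fun m x => by
    have hker : LinearMap.ker (xᴴ * x).mulVecLin = LinearMap.ker x.mulVecLin := by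
      ext v
      simp only [LinearMap.mem_ker, mulVecLin_apply]
      constructor
      · intro hv
        have h1 : star (x *ᵥ v) ⬝ᵥ (x *ᵥ v) = 0 := by
          rw [star_mulVec, ← dotProduct_mulVec, mulVec_mulVec, hv, dotProduct_zero]
        exact funext (hK _ _ h1)
      · intro hv
        rw [← mulVec_mulVec, hv, mulVec_zero]
    have h1 := LinearMap.finrank_range_add_finrank_ker (xᴴ * x).mulVecLin
    have h2 := LinearMap.finrank_range_add_finrank_ker x.mulVecLin
    rw [hker] at h1
    exact Nat.add_right_cancel (h1.trans h2.symm)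
  obtain ⟨x, rfl⟩ : ∃ x, cls n K x = a := ⟨_, cls_rep a⟩
  rw [star_cls, ← map_mul, ← map_zero (cls n K), cls_eq_iff, sub_zero, mem_null] at h
  rw [← map_zero (cls n K), cls_eq_iff, sub_zero, mem_null]
  refine h.congr fun m => ?_
  change rkElem ((x.1 m)ᴴ * x.1 m) = _
  rw [rkElem, hrank, rkElem]

end CompletionUnits

/-! ### Polynomials in the image of `t` -/

section Polynomials

variable (n : ℕ → ℕ) [∀ i, (n i).AtLeastTwo] (K : Type*) [Field K]

/-- The homomorphism from `C_K(X)` to the completion. -/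
def funHom : LocallyConstant (Space n) K →+* Completion n K := (cls n K).comp (diag n K)

/-- The scalars in the completion. -/
def scalarHom : K →+* Completion n K := (funHom n K).comp LocallyConstant.constRingHom

/-- The evaluation of polynomials at the Cauchy sequence `shift` that represents `t`. -/
def polySeq : K[X] →+* cauchy n K :=
  eval₂RingHom' ((diag n K).comp LocallyConstant.constRingHom) (shift n K) fun a =>
    Subtype.ext <| funext fun m => by
      change diagonal (fun _ => a) * shiftMat n K m = shiftMat n K m * diagonal fun _ => a
      ext i j
      rw [diagonal_mul, mul_diagonal, mul_comm]

theorem polySeq_C (a : K) : polySeq n K (C a) = diag n K (LocallyConstant.const _ a) :=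
  eval₂_C _ _

theorem polySeq_X : polySeq n K X = shift n K := eval₂_X _ _

theorem polySeq_apply (q : K[X]) (m : ℕ) : (polySeq n K q).1 m = aeval (shiftMat n K m) q := by
  have h : (evalLevel n K m).comp (polySeq n K) = (aeval (shiftMat n K m)).toRingHom := by
    refine Polynomial.ringHom_ext (fun a => ?_) ?_
    · rw [RingHom.comp_apply, polySeq_C, AlgHom.toRingHom_eq_coe, RingHom.coe_coe, aeval_C]
      rfl
    · rw [RingHom.comp_apply, polySeq_X, AlgHom.toRingHom_eq_coe, RingHom.coe_coe, aeval_X]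
      rfl
  exact congrArg (fun g => g q) h

/-- The evaluation of polynomials over `K` at the element `t ^ p_m` of the completion. -/
def polyHom (m : ℕ) : K[X] →+* Completion n K :=
  ((cls n K).comp (polySeq n K)).comp (expand K (p n m)).toRingHom

theorem polyHom_C (m : ℕ) (a : K) : polyHom n K m (C a) = scalarHom n K a := by
  simp only [polyHom, RingHom.comp_apply, AlgHom.toRingHom_eq_coe, RingHom.coe_coe, expand_C]
  refine congrArg (cls n K) ?_
  rw [polySeq_C]
  rfl

variable [StarRing K]

/-- The power `t ^ k` in the completion. -/
def tPow (k : ℤ) : Completion n K := ((tUnit n K ^ k : (Completion n K)ˣ) : Completion n K)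

variable {n K}

theorem tPow_add (k l : ℤ) : tPow n K (k + l) = tPow n K k * tPow n K l := by
  rw [tPow, _root_.zpow_add, Units.val_mul]; rfl

theorem tPow_zero : tPow n K 0 = 1 := by simp [tPow]

theorem tPow_mul_funHom (k : ℤ) (f : LocallyConstant (Space n) K) :
    tPow n K k * funHom n K f = funHom n K (Multiplicative.ofAdd k • f) * tPow n K k :=
  (diag_mul_tUnit_zpow n K (Multiplicative.ofAdd k) f).symm

theorem cls_polySeq_X : cls n K (polySeq n K X) = tUnit n K :=
  congrArg (cls n K) (polySeq_X n K)

theorem polyHom_X (m : ℕ) : polyHom n K m X = tPow n K (p n m) := by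
  simp only [polyHom, RingHom.comp_apply, AlgHom.toRingHom_eq_coe, RingHom.coe_coe, expand_X]
  rw [map_pow, map_pow, cls_polySeq_X, tPow, zpow_natCast, Units.val_pow_eq_pow_val]

/-- Nonzero polynomials in `t ^ p_m` are invertible in the completion: up to a power of `t` they
are polynomials in `t` with nonzero constant term. -/
theorem isUnit_polyHom (m : ℕ) {q : K[X]} (hq : q ≠ 0) : IsUnit (polyHom n K m q) := by
  have h0 : expand K (p n m) q ≠ 0 := (expand_ne_zero (p_pos m)).2 hq
  obtain ⟨r, hr, hX⟩ := exists_eq_pow_rootMultiplicity_mul_and_not_dvd _ h0 0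
  rw [C_0, sub_zero] at hr hX
  simp only [polyHom, RingHom.comp_apply, AlgHom.toRingHom_eq_coe, RingHom.coe_coe]
  rw [hr, map_mul, map_mul, map_pow, map_pow, cls_polySeq_X]
  refine ((tUnit n K).isUnit.pow _).mul (isUnit_cls fun l => ?_)
  rw [polySeq_apply]
  exact isUnit_aeval_shiftMat l hX

/-- A polynomial in `t ^ p_m` lies in every subring that contains the scalars and `t ^ p_m`. -/
theorem polyHom_mem {m : ℕ} {B : Subring (Completion n K)} (hs : ∀ a, scalarHom n K a ∈ B)
    (ht : tPow n K (p n m) ∈ B) (q : K[X]) : polyHom n K m q ∈ B := by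
  induction q using Polynomial.induction_on' with
  | add q r hq hr => rw [map_add]; exact B.add_mem hq hr
  | monomial k a =>
    rw [← C_mul_X_pow_eq_monomial, map_mul, map_pow, polyHom_C, polyHom_X]
    exact B.mul_mem (hs a) (B.pow_mem ht k)

variable (n K)

/-- The extension of `polyHom` to rational functions. -/
def fracHom (m : ℕ) : FractionRing K[X] →+* Completion n K :=
  (exists_fractionRing_hom (polyHom n K m) fun _ hq => isUnit_polyHom m hq).choose

variable {n K}

theorem fracHom_algebraMap (m : ℕ) (q : K[X]) :
    fracHom n K m (algebraMap _ _ q) = polyHom n K m q :=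
  (exists_fractionRing_hom (polyHom n K m) fun _ hq => isUnit_polyHom m hq).choose_spec q

/-- The elements of the image of `fracHom` are quotients of polynomials in `t ^ p_m`. -/
theorem exists_fracHom_eq (m : ℕ) (z : FractionRing K[X]) : ∃ (q : K[X]) (u : (Completion n K)ˣ),
    (∃ r, polyHom n K m r = u) ∧ fracHom n K m z = polyHom n K m q * (u⁻¹ : (Completion n K)ˣ) := by
  obtain ⟨q, r, hr, rfl⟩ := IsFractionRing.div_surjective K[X] z
  have hr0 := nonZeroDivisors.ne_zero hr
  obtain ⟨u, hu⟩ := isUnit_polyHom (n := n) m hr0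
  refine ⟨q, u, ⟨r, hu.symm⟩, ?_⟩
  rw [Units.eq_mul_inv_iff_mul_eq, hu, ← fracHom_algebraMap, ← fracHom_algebraMap, ← map_mul,
    div_mul_cancel₀]
  simpa using hr0

/-- A rational function of `t ^ p_m` lies in every von Neumann regular subring that contains the
scalars and `t ^ p_m`. -/
theorem fracHom_mem {m : ℕ} {B : Subring (Completion n K)}
    (hB : ∀ x ∈ B, ∃ z ∈ B, x * z * x = x) (hs : ∀ a, scalarHom n K a ∈ B)
    (ht : tPow n K (p n m) ∈ B) (z : FractionRing K[X]) : fracHom n K m z ∈ B := by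
  obtain ⟨q, u, ⟨r, hr⟩, h⟩ := exists_fracHom_eq (n := n) m z
  rw [h]
  exact B.mul_mem (polyHom_mem hs ht q) (inv_mem_of_regular hB (hr ▸ polyHom_mem hs ht r))

end Polynomials

/-! ### Matrix units and the subrings `M_{p_m}(K(t ^ p_m))` -/

section Level

variable {n : ℕ → ℕ} [∀ i, (n i).AtLeastTwo] {K : Type*} [Field K]

theorem smul_residue (m : ℕ) (k : ℤ) (g : ZMod (p n m) → K) :
    Multiplicative.ofAdd k • (residue m).map g = (residue (n := n) m).map fun a => g (a - k) := by
  ext x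
  change g (residue m ((T n ^ (-k)) x)) = g (residue m x - k)
  rw [residue_zpow]
  congr 1
  push_cast; ring

variable (n K) in
/-- The characteristic function of `T^i(E_m)`. -/
def indicator (m : ℕ) (i : ZMod (p n m)) : LocallyConstant (Space n) K :=
  (residue m).map (Pi.single i 1)

theorem smul_indicator (m : ℕ) (k : ℤ) (i : ZMod (p n m)) :
    Multiplicative.ofAdd k • indicator n K m i = indicator n K m (i + k) := by
  rw [indicator, smul_residue, indicator]
  congr 1
  funext a
  simp only [Pi.single_apply, sub_eq_iff_eq_add]

theorem indicator_mul (m : ℕ) (i j : ZMod (p n m)) :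
    indicator n K m i * indicator n K m j = if i = j then indicator n K m i else 0 := by
  ext x
  change (Pi.single i 1 : ZMod (p n m) → K) (residue m x) * (Pi.single j 1 : ZMod (p n m) → K) _ = _
  split_ifs with h
  · subst h
    change _ = (Pi.single i 1 : ZMod (p n m) → K) (residue m x)
    simp only [Pi.single_apply]
    split_ifs <;> simp
  · simp only [Pi.single_apply]
    split_ifs with h1 h2
    · exact absurd (h1.symm.trans h2) h
    all_goals simp

theorem sum_const_mul_indicator (m : ℕ) (g : ZMod (p n m) → K) :
    ∑ i, LocallyConstant.constRingHom (g i) * indicator n K m i = (residue m).map g := by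
  ext x
  have h : ∀ f : ZMod (p n m) → LocallyConstant (Space n) K, (∑ i, f i) x = ∑ i, f i x := fun f =>
    map_sum (LocallyConstant.evalRingHom x) f _
  rw [h]
  change ∑ i, g i * (Pi.single i 1 : ZMod (p n m) → K) (residue m x) = g (residue m x)
  simp [Pi.single_apply]

variable [StarRing K]

variable (n K) in
/-- The matrix unit `e_{ij} = χ_{T^i(E_m)} t^(i-j)`. The indices are residues modulo `p_m`, but the
exponent `i - j` is the difference of their representatives in `{0, …, p_m - 1}`. -/
def matUnit (m : ℕ) (i j : ZMod (p n m)) : Completion n K :=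
  funHom n K (indicator n K m i) * tPow n K (i.val - j.val)

theorem intCast_val_sub (m : ℕ) (i j : ZMod (p n m)) :
    (((i.val : ℤ) - j.val : ℤ) : ZMod (p n m)) = i - j := by simp

theorem matUnit_self (m : ℕ) (i : ZMod (p n m)) :
    matUnit n K m i i = funHom n K (indicator n K m i) := by
  rw [matUnit, sub_self, tPow_zero, mul_one]

theorem matUnit_mul (m : ℕ) (i j k l : ZMod (p n m)) :
    matUnit n K m i j * matUnit n K m k l = if j = k then matUnit n K m i l else 0 := by
  rw [matUnit, matUnit, mul_assoc, ← mul_assoc (tPow _ _ _), tPow_mul_funHom, smul_indicator,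
    intCast_val_sub, mul_assoc, ← mul_assoc, ← map_mul, indicator_mul, ← tPow_add]
  by_cases h : j = k
  · subst h
    rw [if_pos (by ring), if_pos rfl, matUnit]
    congr 2
    ring
  · have h' : i ≠ k + (i - j) := fun h1 => h (by linear_combination h1)
    rw [if_neg h', if_neg h, map_zero, zero_mul]

theorem sum_scalar_mul_matUnit (m : ℕ) (g : ZMod (p n m) → K) :
    ∑ i, scalarHom n K (g i) * matUnit n K m i i = funHom n K ((residue m).map g) := by
  rw [← sum_const_mul_indicator, map_sum]
  refine Finset.sum_congr rfl fun i _ => ?_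
  rw [matUnit_self, map_mul]
  rfl

theorem sum_matUnit (m : ℕ) : ∑ i, matUnit n K m i i = 1 := by
  have h := sum_scalar_mul_matUnit (K := K) (n := n) m 1
  simp only [Pi.one_apply, map_one, one_mul] at h
  rw [h, ← map_one (funHom n K)]
  rfl

theorem commute_scalarHom_matUnit (m : ℕ) (a : K) (i j : ZMod (p n m)) :
    Commute (scalarHom n K a) (matUnit n K m i j) := by
  have h1 : Commute (scalarHom n K a) (funHom n K (indicator n K m i)) := by
    change funHom n K _ * _ = _ * funHom n K _
    rw [← map_mul, ← map_mul, mul_comm]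
  have h2 : ∀ k, Commute (scalarHom n K a) (tPow n K k) := fun k =>
    (tPow_mul_funHom k (LocallyConstant.constRingHom a)).symm
  exact h1.mul_right (h2 _)

theorem commute_tPow_matUnit (m : ℕ) (i j : ZMod (p n m)) :
    Commute (tPow n K (p n m)) (matUnit n K m i j) := by
  have h1 : Commute (tPow n K (p n m)) (funHom n K (indicator n K m i)) := by
    change _ * _ = _ * _
    rw [tPow_mul_funHom, smul_indicator]
    simp
  have h2 : ∀ k, Commute (tPow n K (p n m)) (tPow n K k) := fun k => by
    change _ * _ = _ * _
    rw [← tPow_add, ← tPow_add, add_comm]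
  exact h1.mul_right (h2 _)

theorem commute_fracHom_matUnit (m : ℕ) (z : FractionRing K[X]) (i j : ZMod (p n m)) :
    Commute (fracHom n K m z) (matUnit n K m i j) := by
  have hq : ∀ q, Commute (polyHom n K m q) (matUnit n K m i j) := fun q =>
    (Subring.mem_centralizer_iff.1 (polyHom_mem (B := Subring.centralizer {matUnit n K m i j})
      (fun a => Subring.mem_centralizer_iff.2 fun _ h =>
        h ▸ (commute_scalarHom_matUnit m a i j).symm.eq)
      (Subring.mem_centralizer_iff.2 fun _ h => h ▸ (commute_tPow_matUnit m i j).symm.eq) q)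
      _ rfl).symm
  obtain ⟨q, u, ⟨r, hr⟩, h⟩ := exists_fracHom_eq (n := n) m z
  rw [h]
  exact (hq q).mul_left (Commute.units_inv_left (hr ▸ hq r))

variable (n K) in
/-- The homomorphism from `M_{p_m}(K(X))` to the completion that takes `X` to `t ^ p_m`. -/
def levelHom (m : ℕ) :
    Matrix (ZMod (p n m)) (ZMod (p n m)) (FractionRing K[X]) →+* Completion n K :=
  matrixHom (fracHom n K m) (matUnit n K m) (sum_matUnit m) (matUnit_mul m)
    (commute_fracHom_matUnit m)

theorem levelHom_diagonal (m : ℕ) (w : ZMod (p n m) → FractionRing K[X]) :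
    levelHom n K m (diagonal w) = ∑ i, fracHom n K m (w i) * matUnit n K m i i := by
  rw [levelHom, matrixHom_apply]
  refine Finset.sum_congr rfl fun i _ => ?_
  rw [Finset.sum_eq_single i, diagonal_apply_eq]
  · intro j _ hj
    rw [diagonal_apply_ne _ hj.symm, map_zero, zero_mul]
  · simp

variable (n K) in
/-- The image `M_{p_m}(K(t ^ p_m))` of `levelHom` in the completion. -/
def levelRing (m : ℕ) : Subring (Completion n K) := (levelHom n K m).range

theorem levelHom_apply (m : ℕ) (A : Matrix (ZMod (p n m)) (ZMod (p n m)) (FractionRing K[X])) :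
    levelHom n K m A = ∑ i, ∑ j, fracHom n K m (A i j) * matUnit n K m i j := rfl

theorem mem_levelRing {m : ℕ} {x : Completion n K} :
    x ∈ levelRing n K m ↔ ∃ A, levelHom n K m A = x := Iff.rfl

theorem levelRing_regular (m : ℕ) :
    ∀ x ∈ levelRing n K m, ∃ z ∈ levelRing n K m, x * z * x = x := by
  intro x hx
  obtain ⟨A, rfl⟩ := mem_levelRing.1 hx
  obtain ⟨Z, hZ⟩ := exists_mul_mul_eq_self A
  exact ⟨levelHom n K m Z, ⟨Z, rfl⟩, by rw [← map_mul, ← map_mul, hZ]⟩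

theorem fracHom_mem_levelRing (m : ℕ) (z : FractionRing K[X]) :
    fracHom n K m z ∈ levelRing n K m := by
  refine mem_levelRing.2 ⟨diagonal fun _ => z, ?_⟩
  rw [levelHom_diagonal]
  exact (Finset.mul_sum _ _ _).symm.trans
    ((congrArg (fracHom n K m z * ·) (sum_matUnit m)).trans (mul_one _))

theorem matUnit_mem_levelRing (m : ℕ) (i j : ZMod (p n m)) :
    matUnit n K m i j ∈ levelRing n K m := by
  refine mem_levelRing.2 ⟨Matrix.single i j 1, ?_⟩
  rw [levelHom_apply, Finset.sum_eq_single i, Finset.sum_eq_single j]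
  · simp
  · intro k _ hk
    simp [hk.symm]
  · simp
  · intro k _ hk
    simp [hk.symm]
  · simp

theorem scalarHom_mem_levelRing (m : ℕ) (a : K) : scalarHom n K a ∈ levelRing n K m := by
  rw [← polyHom_C n K m, ← fracHom_algebraMap]
  exact fracHom_mem_levelRing m _

theorem funHom_mem_levelRing (m : ℕ) (g : ZMod (p n m) → K) :
    funHom n K ((residue m).map g) ∈ levelRing n K m := by
  rw [← sum_scalar_mul_matUnit]
  exact sum_mem fun i _ => mul_mem (scalarHom_mem_levelRing m _) (matUnit_mem_levelRing m i i)

theorem tPow_mul_mem_levelRing (m : ℕ) (k : ℤ) : tPow n K (p n m * k) ∈ levelRing n K m := by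
  have h1 : ((tUnit n K ^ (p n m : ℤ) : (Completion n K)ˣ) : Completion n K) ∈ levelRing n K m := by
    have h := fracHom_mem_levelRing (n := n) (K := K) m (algebraMap K[X] _ X)
    rwa [fracHom_algebraMap, polyHom_X] at h
  have h2 := inv_mem_of_regular (levelRing_regular m) h1
  rw [tPow, _root_.zpow_mul]
  obtain ⟨k, rfl | rfl⟩ := k.eq_nat_or_neg
  · rw [zpow_natCast, Units.val_pow_eq_pow_val]
    exact pow_mem h1 k
  · rw [_root_.zpow_neg, zpow_natCast, ← inv_pow, Units.val_pow_eq_pow_val]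
    exact pow_mem h2 k

theorem tPow_mem_levelRing (m : ℕ) (k : ℤ) : tPow n K k ∈ levelRing n K m := by
  have h : ∑ i, matUnit n K m i i * tPow n K k = tPow n K k := 
    (Finset.sum_mul _ _ _).symm.trans
      ((congrArg (· * tPow n K k) (sum_matUnit m)).trans (one_mul _))
  rw [← h]
  refine sum_mem fun i _ => ?_
  have h1 : (((k - (i.val - (i - k : ZMod (p n m)).val) : ℤ)) : ZMod (p n m)) = 0 := by
    push_cast
    simp
  obtain ⟨s, hs⟩ := (ZMod.intCast_zmod_eq_zero_iff_dvd _ _).1 h1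
  -- `χ_i t^k = e_{i,i-k} t^(p_m s)`, the index `i - k` being taken modulo `p_m`
  have h2 : matUnit n K m i i * tPow n K k = matUnit n K m i (i - k) * tPow n K (p n m * s) := by
    rw [matUnit_self, matUnit, mul_assoc, ← tPow_add, ← hs]
    congr 2
    ring
  rw [h2]
  exact mul_mem (matUnit_mem_levelRing m _ _) (tPow_mul_mem_levelRing m s)

/-- `levelRing m` is the smallest von Neumann regular subring that contains the powers of `t` and
the functions of the first `m` digits. -/
theorem levelRing_le {m : ℕ} {B : Subring (Completion n K)}
    (hB : ∀ x ∈ B, ∃ z ∈ B, x * z * x = x) (ht : ∀ k, tPow n K k ∈ B)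
    (hf : ∀ g : ZMod (p n m) → K, funHom n K ((residue m).map g) ∈ B) : levelRing n K m ≤ B := by
  intro x hx
  obtain ⟨A, rfl⟩ := mem_levelRing.1 hx
  rw [levelHom_apply]
  exact sum_mem fun i _ => sum_mem fun j _ =>
    mul_mem (fracHom_mem hB (fun a => hf fun _ => a) (ht _) _) (mul_mem (hf _) (ht _))

theorem levelRing_mono : Monotone (levelRing n K) := fun m l h =>
  levelRing_le (levelRing_regular l) (tPow_mem_levelRing l) fun g => by
    obtain ⟨g', hg⟩ := exists_residue_eq h g
    rw [hg]
    exact funHom_mem_levelRing l g'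

/-- The subring of the elements whose adjoints lie in `B`. -/
def starPreimage {R : Type*} [Ring R] [StarRing R] (B : Subring R) : Subring R where
  carrier := {x | star x ∈ B}
  one_mem' := by simp
  zero_mem' := by simp
  add_mem' hx hy := by simpa using B.add_mem hx hy
  mul_mem' hx hy := by simpa using B.mul_mem hy hx
  neg_mem' hx := by simpa using hx

/-- The elements whose adjoints lie in `levelRing m` form a regular subring that contains the
powers of `t` and the functions of the first `m` digits, so `levelRing_le` applies. -/
theorem star_mem_levelRing {m : ℕ} {x : Completion n K} (hx : x ∈ levelRing n K m) :
    star x ∈ levelRing n K m := by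
  refine levelRing_le (B := starPreimage (levelRing n K m)) (fun x hx => ?_) (fun k => ?_)
    (fun g => ?_) hx
  · obtain ⟨z, hz, h⟩ := levelRing_regular m _ hx
    refine ⟨star z, by simpa [starPreimage] using hz, ?_⟩
    rw [← star_inj, ← h]
    simp [mul_assoc]
  · have h1 : star (tUnit n K) = (tUnit n K)⁻¹ := Units.ext rfl
    change star ((tUnit n K ^ k : (Completion n K)ˣ) : Completion n K) ∈ levelRing n K m
    rw [← Units.coe_star, star_zpow, h1, _root_.inv_zpow, ← _root_.zpow_neg]
    exact tPow_mem_levelRing m (-k)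
  · have h1 : star (diag n K ((residue m).map g)) = diag n K ((residue m).map (star g)) :=
      Subtype.ext (funext fun l => diagonal_conjTranspose _)
    change star (cls n K (diag n K ((residue m).map g))) ∈ levelRing n K m
    rw [star_cls, h1]
    exact funHom_mem_levelRing m _

variable (n K) in
/-- The increasing union of the rings `M_{p_m}(K(t ^ p_m))`. -/
def limitRing : Subring (Completion n K) := ⨆ m, levelRing n K m

theorem mem_limitRing {x : Completion n K} : x ∈ limitRing n K ↔ ∃ m, x ∈ levelRing n K m :=
  Subring.mem_iSup_of_directed levelRing_mono.directed_le

theorem isStarRegular_limitRing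
    (hK : ∀ (r : ℕ) (a : Fin r → K), ∑ i, star (a i) * a i = 0 → ∀ i, a i = 0) :
    IsStarRegular (limitRing n K) := by
  refine ⟨fun x hx => ?_, fun x hx => ?_, fun x _ h => eq_zero_of_star_mul_self hK h⟩
  · obtain ⟨m, hm⟩ := mem_limitRing.1 hx
    exact mem_limitRing.2 ⟨m, star_mem_levelRing hm⟩
  · obtain ⟨m, hm⟩ := mem_limitRing.1 hx
    obtain ⟨z, hz, h⟩ := levelRing_regular m x hm
    exact ⟨z, mem_limitRing.2 ⟨m, hz⟩, h⟩

theorem piRk_mem_limitRing (a : OdometerAlgebra n K) : piRk n K a ∈ limitRing n K := by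
  induction a using SkewMonoidAlgebra.induction_on with
  | zero => rw [map_zero]; exact zero_mem _
  | add a b ha hb => rw [map_add]; exact add_mem ha hb
  | single k f =>
    rw [piRk_single]
    obtain ⟨m, hm⟩ := exists_comp_residue f
    obtain ⟨g, rfl⟩ := hm m le_rfl
    exact mem_limitRing.2 ⟨m, mul_mem (funHom_mem_levelRing m g) (tPow_mem_levelRing m _)⟩

theorem regClosure_le_limitRing
    (hK : ∀ (r : ℕ) (a : Fin r → K), ∑ i, star (a i) * a i = 0 → ∀ i, a i = 0) :
    regClosure n K ≤ limitRing n K :=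
  sInf_le ⟨isStarRegular_limitRing hK, by rintro _ ⟨a, rfl⟩; exact piRk_mem_limitRing a⟩

theorem piRk_mem_regClosure (a : OdometerAlgebra n K) : piRk n K a ∈ regClosure n K :=
  Subring.mem_sInf.2 fun _ hB => hB.2 ⟨a, rfl⟩

end Level

/-! ### The values of the rank functions -/

/-- Gaussian elimination over `F`, transported along a homomorphism from a matrix ring over `F`. -/
theorem exists_units_mul_map_eq_diagonal {ι κ F R : Type*} [Fintype ι] [DecidableEq ι] [Fintype κ]
    [DecidableEq κ] [Field F] [Ring R] (Φ : Matrix ι ι F →+* R) (A : Matrix κ κ (Matrix ι ι F)) :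
    ∃ (V U : Matrix κ κ R) (w : κ → ι → F), IsUnit V ∧ IsUnit U ∧
      V * A.map Φ * U = diagonal (fun i => Φ (diagonal (w i))) ∧ ∀ i j, w i j = 0 ∨ w i j = 1 := by
  obtain ⟨V, U, w, hV, hU, h, hw⟩ := exists_units_mul_eq_diagonal (compRingEquiv κ ι F A)
  let f := (compRingEquiv κ ι F).symm
  refine ⟨Φ.mapMatrix (f V), Φ.mapMatrix (f U), fun i j => w (i, j), (hV.map f).map Φ.mapMatrix,
    (hU.map f).map Φ.mapMatrix, ?_, fun i j => hw _⟩
  have h1 : f V * A * f U = diagonal fun i => diagonal fun j => w (i, j) := by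
    refine (compRingEquiv κ ι F).injective ?_
    rw [map_mul, map_mul, RingEquiv.apply_symm_apply, RingEquiv.apply_symm_apply, h,
      compRingEquiv_apply, comp_diagonal_diagonal]
  rw [← RingHom.mapMatrix_apply, ← map_mul, ← map_mul, h1, RingHom.mapMatrix_apply,
    diagonal_map (map_zero Φ)]

section Values

variable {n : ℕ → ℕ} [∀ i, (n i).AtLeastTwo] {K : Type*} [Field K] [StarRing K]

theorem exists_rkCompletion_eq {k : ℕ} {A : Matrix (Fin k) (Fin k) (Completion n K)}
    (hA : ∀ i j, A i j ∈ limitRing n K) : ∃ c m : ℕ, rkCompletion A = c / p n m := by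
  classical
  choose M hM using fun i j => mem_limitRing.1 (hA i j)
  -- a level that contains all entries of `A`
  let m := Finset.univ.sup fun i => Finset.univ.sup fun j => M i j
  have hm : ∀ i j, A i j ∈ levelRing n K m := fun i j =>
    levelRing_mono ((Finset.le_sup (f := fun j => M i j) (Finset.mem_univ j)).trans
      (Finset.le_sup (f := fun i => Finset.univ.sup fun j => M i j) (Finset.mem_univ i))) (hM i j)
  choose B hB using fun i j => mem_levelRing.1 (hm i j)
  obtain ⟨V, U, w, hV, hU, h, hw⟩ :=
    exists_units_mul_map_eq_diagonal (levelHom n K m) (Matrix.of B)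
  have hBA : (Matrix.of B).map (levelHom n K m) = A := by ext i j; exact hB i j
  have hd : ∀ i, levelHom n K m (diagonal (w i))
      = cls n K (diag n K ((residue m).map fun j => if w i j = 0 then 0 else 1)) := fun i => by
    rw [levelHom_diagonal]
    refine Eq.trans (Finset.sum_congr rfl fun j _ => ?_) (sum_scalar_mul_matUnit m _)
    rcases hw i j with h | h <;> simp [h]
  have hr : rkCompletion A = rkCompletion (diagonal fun i =>
      cls n K (diag n K ((residue m).map fun j => if w i j = 0 then 0 else 1))) := by
    rw [← rkCompletion_units_mul hV hU, ← hBA]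
    refine congrArg rkCompletion (h.trans ?_)
    exact congrArg diagonal (funext hd)
  exact ⟨_, m, hr.trans (rkCompletion_diagonal m _)⟩

variable (n K) in
/-- Every multiple of `1 / p_m` between `0` and `k` is the rank of a diagonal `k × k` matrix of
characteristic functions. -/
theorem exists_rkOdometer_eq {k m c : ℕ} (hc : c ≤ k * p n m) :
    ∃ A : Matrix (Fin k) (Fin k) (OdometerAlgebra n K), rkOdometer A = c / p n m := by
  classical
  let g : Fin k → ZMod (p n m) → K := fun i a => if a.val + p n m * i < c then 1 else 0
  refine ⟨diagonal fun i => SkewMonoidAlgebra.single 1 ((residue m).map (g i)), ?_⟩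
  have h : ∀ i, piRk n K (SkewMonoidAlgebra.single 1 ((residue m).map (g i)))
      = cls n K (diag n K ((residue m).map (g i))) := fun i => by
    rw [piRk_single, toAdd_one, zpow_zero, Units.val_one, mul_one]
  rw [rkOdometer, diagonal_map (map_zero _)]
  refine (congrArg rkCompletion (congrArg diagonal (funext h))).trans ?_
  rw [rkCompletion_diagonal]
  congr 2
  let e : Fin k × Fin (p n m) ≃ Fin (k * p n m) := finProdFinEquiv
  have h1 : ∀ ij : Fin k × Fin (p n m), g ij.1 (ij.2 : ℕ) ≠ 0 ↔ (e ij : ℕ) < c :=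
    fun ij => by
      simp [g, e, ZMod.val_cast_of_lt ij.2.isLt, finProdFinEquiv]
  rw [Nat.card_congr (e.subtypeEquiv (q := fun a : Fin (k * p n m) => (a : ℕ) < c) h1),
    Nat.card_congr (β := Fin c) ⟨fun a => ⟨a.1, a.2⟩, fun a => ⟨⟨a, a.2.trans_le hc⟩, a.2⟩,
    fun _ => rfl, fun _ => rfl⟩, Nat.card_fin]

theorem mem_ZReal {x : ℝ} : x ∈ ZReal n ↔ ∃ (a : ℤ) (r : ℕ), x = a / p n r := by
  constructor
  · rintro ⟨y, hy, rfl⟩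
    obtain ⟨a, r, rfl⟩ := (mem_Z n).1 hy
    exact ⟨a, r, by simp⟩
  · rintro ⟨a, r, rfl⟩
    exact ⟨a / p n r, (mem_Z n).2 ⟨a, r, rfl⟩, by simp⟩

theorem mem_ZPos {x : ℝ} : x ∈ ZPos n ↔ ∃ c r : ℕ, x = c / p n r := by
  constructor
  · rintro ⟨hx, h0⟩
    obtain ⟨a, r, rfl⟩ := mem_ZReal.1 hx
    have hp : (0 : ℝ) < p n r := by exact_mod_cast p_pos r
    have ha : 0 ≤ a := by
      rw [le_div_iff₀ hp, zero_mul] at h0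
      exact_mod_cast h0
    lift a to ℕ using ha
    exact ⟨a, r, by simp⟩
  · rintro ⟨c, r, rfl⟩
    exact ⟨mem_ZReal.2 ⟨c, r, by simp⟩, by positivity⟩

theorem natCast_mem_ZReal (k : ℕ) : (k : ℝ) ∈ ZReal n := mem_ZReal.2 ⟨k, 0, by simp [p]⟩

theorem closure_ZPos : AddSubgroup.closure (ZPos n) = ZReal n := by
  refine le_antisymm ((AddSubgroup.closure_le _).2 fun x hx => hx.1) fun x hx => ?_
  obtain h | h := le_total 0 x
  · exact AddSubgroup.subset_closure ⟨hx, h⟩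
  · rw [← neg_neg x]
    exact neg_mem (AddSubgroup.subset_closure ⟨neg_mem hx, neg_nonneg.2 h⟩)

variable (n K)

theorem rkOdometer_mem {k : ℕ} (A : Matrix (Fin k) (Fin k) (OdometerAlgebra n K)) :
    rkOdometer A ∈ ZPos n :=
  mem_ZPos.2 (exists_rkCompletion_eq fun _ _ => piRk_mem_limitRing _)

theorem rankValues_odometer :
    rankValues (fun k (A : Matrix (Fin k) (Fin k) (OdometerAlgebra n K)) => rkOdometer A)
      = ZPos n := by
  ext x
  constructor
  · rintro ⟨k, -, A, rfl⟩
    exact rkOdometer_mem n K A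
  · intro hx
    obtain ⟨c, m, rfl⟩ := mem_ZPos.1 hx
    have hc : c ≤ (c + 1) * p n m := by nlinarith [p_pos (n := n) m]
    obtain ⟨A, hA⟩ := exists_rkOdometer_eq n K hc
    exact ⟨c + 1, by omega, A, hA.symm⟩

theorem bettiNumbers_odometer :
    bettiNumbers (fun k (A : Matrix (Fin k) (Fin k) (OdometerAlgebra n K)) => rkOdometer A)
      = ZPos n := by
  ext x
  constructor
  · rintro ⟨k, -, A, rfl⟩
    exact ⟨sub_mem (natCast_mem_ZReal k) (rkOdometer_mem n K A).1,
      sub_nonneg.2 (rkCompletion_le _)⟩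
  · intro hx
    obtain ⟨c, m, rfl⟩ := mem_ZPos.1 hx
    have hc : c ≤ (c + 1) * p n m := by nlinarith [p_pos (n := n) m]
    -- the matrix has rank `(c + 1) - c / p_m`
    obtain ⟨A, hA⟩ := exists_rkOdometer_eq n K (Nat.sub_le ((c + 1) * p n m) c)
    refine ⟨c + 1, by omega, A, ?_⟩
    have hp : (p n m : ℝ) ≠ 0 := by exact_mod_cast (p_pos m).ne'
    beta_reduce
    rw [hA, Nat.cast_sub hc]
    push_cast
    field_simp
    ring

theorem rankValues_regClosure
    (hK : ∀ (r : ℕ) (a : Fin r → K), ∑ i, star (a i) * a i = 0 → ∀ i, a i = 0) :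
    rankValues (fun k (A : Matrix (Fin k) (Fin k) (regClosure n K)) => rkRegClosure A)
      = ZPos n := by
  ext x
  constructor
  · rintro ⟨k, -, A, rfl⟩
    exact mem_ZPos.2 (exists_rkCompletion_eq fun i j => regClosure_le_limitRing hK (A i j).2)
  · rw [← rankValues_odometer n K]
    rintro ⟨k, hk, A, rfl⟩
    exact ⟨k, hk, A.map fun a => ⟨piRk n K a, piRk_mem_regClosure a⟩, rfl⟩

end Values

end

end Odometer

theorem theorem5p6 (n : ℕ → ℕ) [∀ i, (n i).AtLeastTwo] (K : Type*) [Field K] [StarRing K]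
    (hK : ∀ (r : ℕ) (a : Fin r → K), ∑ i, star (a i) * a i = 0 → ∀ i, a i = 0) :
    Odometer.rankValues (fun k (A : Matrix (Fin k) (Fin k) (Odometer.OdometerAlgebra n K)) =>
        Odometer.rkOdometer A) = Odometer.ZPos n ∧
    Odometer.bettiNumbers (fun k (A : Matrix (Fin k) (Fin k) (Odometer.OdometerAlgebra n K)) =>
        Odometer.rkOdometer A) = Odometer.ZPos n ∧
    Odometer.rankValues (fun k (A : Matrix (Fin k) (Fin k) (Odometer.regClosure n K)) =>
        Odometer.rkRegClosure A) = Odometer.ZPos n ∧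
    AddSubgroup.closure (Odometer.bettiNumbers
        (fun k (A : Matrix (Fin k) (Fin k) (Odometer.OdometerAlgebra n K)) =>
          Odometer.rkOdometer A)) = Odometer.ZReal n := by
  refine ⟨Odometer.rankValues_odometer n K, Odometer.bettiNumbers_odometer n K,
    Odometer.rankValues_regClosure n K hK, ?_⟩
  rw [Odometer.bettiNumbers_odometer, Odometer.closure_ZPos]
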